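/- **Conventions.** Surreal numbers are Conway's pairs $x=\{L_x\mid R_x\}$ of sets of surreal numbers, built along the days: $\mathrm{Day}(\alpha)$ consists of the pairs with $L_x,R_x\subseteq\bigcup_{\beta<\alpha}\mathrm{Day}(\beta)$ and no member of $R_x$ being $\le$ any member of $L_x$; here $x\le y$ iff $y\not\le l$ for every $l\in L_x$ and $r\not\le x$ for every $r\in R_y$. Write $x\thickapprox y$ for $x\le y\wedge y\le x$, $x<y$ for $x\le y\wedge y\not\le x$, $0_{\mathbf{No}}=\{\,\mid\,\}$, and let $\mathfrak b(x)$ be the least $\alpha$ with $x\in\mathrm{Day}(\alpha)$. The operations $-x$, $x+y$, $x\cdot y$ are Conway's, and $|x|$ is $x$ if $0_{\mathbf{No}}\le x$ and $-x$ otherwise. *Canonical surreals.* Each class $[x]_\thickapprox$ has a representative $\mathrm{Uniq}(x)$, selected by transfinite recursion: among the youngest members (those of least $\mathfrak b$) $c$ of the class all of whose left and right members are canonical representatives selected on earlier days, one with the least Hessenberg sum of the cardinalities of $L_c$ and $R_c$ is taken by a global choice operator. The values $\mathrm{Uniq}(x)$ are called canonical surreals (uSurreals). *Embeddings.* For integers,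 $\mathrm s_{\mathbb Z}(0)=0_{\mathbf{No}}$, $\mathrm s_{\mathbb Z}(i)=\{\mathrm s_{\mathbb Z}(i-1)\mid\,\}$ for $i>0$, and $\mathrm s_{\mathbb Z}(i)=\{\,\mid \mathrm s_{\mathbb Z}(i+1)\}$ for $i<0$. For dyadic numbers, $\mathrm s_{\mathbb D}(d)=\mathrm s_{\mathbb Z}(d)$ for integers $d$ and $\mathrm s_{\mathbb D}\bigl(\tfrac{2j+1}{2^{p+1}}\bigr)=\{\mathrm s_{\mathbb D}(\tfrac{j}{2^p})\mid \mathrm s_{\mathbb D}(\tfrac{j+1}{2^p})\}$. For real $r$, $\mathrm s_{\mathbb R}(r)=\mathrm{Uniq}\,\bigl\{\mathrm s_{\mathbb D}\bigl(\tfrac{\lceil r2^n-1\rceil}{2^n}\bigr)\mid \mathrm s_{\mathbb D}\bigl(\tfrac{\lfloor r2^n+1\rfloor}{2^n}\bigr)\bigr\}_{n\in\mathbb N}$. *Powers of $\omega$.* $\omega^x=\{0_{\mathbf{No}},\ \mathrm s_{\mathbb R}(r)\cdot\omega^{x_L}\mid \mathrm s_{\mathbb R}(s)\cdot\omega^{x_R}\}$,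 where $r,s$ range over all positive reals and $x_L$, $x_R$ over $L_x$, $R_x$. *Comparison of sizes.* $x<^\infty y$ ($x$ is infinitely less than $y$) means $x\cdot \mathrm s_{\mathbb Z}(n)<y$ for all $n\in\mathbb N\setminus\{0\}$; $x,y$ are commensurate if $x<\mathrm s_{\mathbb Z}(n)\cdot y$ and $y<\mathrm s_{\mathbb Z}(m)\cdot x$ for some $n,m\in\mathbb N$. **Theorem.** Let $x$ be a surreal number with $x\not\thickapprox 0_{\mathbf{No}}$. Then there exists a unique canonical surreal $y$ for which there is some $r\in\mathbb R\setminus\{0\}$ with $$|x-\mathrm s_{\mathbb R}(r)\cdot\omega^{y}|<^\infty\omega^{y}.$$ Moreover, for this $y$ the leader $\omega^y$ is commensurate in absolute terms with $x$, i.e. $|x|$ and $|\omega^y|$ are commensurate. -/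

import Mathlib

universe u v

/-! ### Pairs of sets, hereditarily

`Game.{u}` is the class of all pairs `⟨L, R⟩` where `L`, `R` are (`u`-small) sets of such pairs:
the initial algebra of `α ↦ 𝒫 α × 𝒫 α`. Equality is set-theoretic: two pairs are equal exactly
when they have the same left and the same right elements. -/

/-- Pairs of `u`-small subsets of `α`. -/
def GamePair (α : Type (u + 1)) : Type (u + 1) :=
  {s : Set α × Set α // Small.{u} s.1 ∧ Small.{u} s.2}

theorem GamePair.ext {α : Type (u + 1)} {s t : GamePair.{u} α}
    (h₁ : s.1.1 = t.1.1) (h₂ : s.1.2 = t.1.2) : s = t :=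
  Subtype.ext (Prod.ext h₁ h₂)

instance GamePair.instFunctor : Functor GamePair.{u} where
  map f s := ⟨(f '' s.1.1, f '' s.1.2), by
    have := s.2.1; have := s.2.2
    exact ⟨inferInstance, inferInstance⟩⟩

noncomputable instance GamePair.instQPF : QPF.{u + 1, u + 1, u + 1} GamePair.{u} where
  P := ⟨Type u × Type u, fun x => ULift.{u + 1} (x.1 ⊕ x.2)⟩
  abs p := ⟨(Set.range (p.2 ∘ ULift.up ∘ Sum.inl), Set.range (p.2 ∘ ULift.up ∘ Sum.inr)),
    ⟨inferInstance, inferInstance⟩⟩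
  repr s := ⟨(@Shrink.{u} s.1.1 s.2.1, @Shrink.{u} s.1.2 s.2.2),
    fun i => Sum.elim (fun i => ((@equivShrink.{u} s.1.1 s.2.1).symm i).1)
      (fun i => ((@equivShrink.{u} s.1.2 s.2.2).symm i).1) i.down⟩
  abs_repr s := by
    have := s.2.1; have := s.2.2
    apply GamePair.ext
    · ext a
      constructor
      · rintro ⟨i, rfl⟩
        exact ((equivShrink.{u} s.1.1).symm i).2
      · intro ha
        exact ⟨equivShrink.{u} s.1.1 ⟨a, ha⟩, by simp⟩
    · ext a
      constructor
      · rintro ⟨i, rfl⟩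
        exact ((equivShrink.{u} s.1.2).symm i).2
      · intro ha
        exact ⟨equivShrink.{u} s.1.2 ⟨a, ha⟩, by simp⟩
  abs_map f p := by
    apply GamePair.ext
    · exact Set.range_comp f (p.2 ∘ ULift.up ∘ Sum.inl)
    · exact Set.range_comp f (p.2 ∘ ULift.up ∘ Sum.inr)

/-- The class of all pairs `{L | R}` of small sets of such pairs. -/
def Game : Type (u + 1) := QPF.Fix GamePair.{u}

namespace Game

/-- The left component `L_x`. -/
def left (x : Game.{u}) : Set Game.{u} := (QPF.Fix.dest (F := GamePair.{u}) x).1.1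

/-- The right component `R_x`. -/
def right (x : Game.{u}) : Set Game.{u} := (QPF.Fix.dest (F := GamePair.{u}) x).1.2

instance small_left (x : Game.{u}) : Small.{u} x.left :=
  (QPF.Fix.dest (F := GamePair.{u}) x).2.1

instance small_right (x : Game.{u}) : Small.{u} x.right :=
  (QPF.Fix.dest (F := GamePair.{u}) x).2.2

/-- The pair `{L | R}`. -/
noncomputable def ofSets (L R : Set Game.{u}) [hL : Small.{u} L] [hR : Small.{u} R] : Game.{u} :=
  QPF.Fix.mk (F := GamePair.{u}) ⟨(L, R), ⟨hL, hR⟩⟩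

@[simp]
theorem left_ofSets (L R : Set Game.{u}) [Small.{u} L] [Small.{u} R] :
    (ofSets L R).left = L :=
  congrArg (fun s => s.1.1) (QPF.Fix.dest_mk (F := GamePair.{u}) _)

@[simp]
theorem right_ofSets (L R : Set Game.{u}) [Small.{u} L] [Small.{u} R] :
    (ofSets L R).right = R :=
  congrArg (fun s => s.1.2) (QPF.Fix.dest_mk (F := GamePair.{u}) _)

@[simp]
theorem ofSets_left_right (x : Game.{u}) : ofSets x.left x.right = x :=
  QPF.Fix.mk_dest (F := GamePair.{u}) x

@[ext]
theorem ext {x y : Game.{u}} (hL : x.left = y.left) (hR : x.right = y.right) : x = y := by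
  rw [← ofSets_left_right x, ← ofSets_left_right y]
  congr 1

/-- `z` is a left or a right element of `x`. -/
def IsOption (z x : Game.{u}) : Prop := z ∈ x.left ∪ x.right

theorem isOption_wf : WellFounded IsOption.{u} := by
  refine ⟨fun x => ?_⟩
  refine QPF.Fix.ind (F := GamePair.{u}) (fun x => Acc IsOption x) ?_ x
  rintro s ⟨t, rfl⟩
  refine ⟨_, fun y hy => ?_⟩
  unfold IsOption left right at hy
  rw [QPF.Fix.dest_mk] at hy
  rcases hy with ⟨a, -, rfl⟩ | ⟨a, -, rfl⟩ <;> exact a.2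

instance : WellFoundedRelation Game.{u} := ⟨IsOption, isOption_wf⟩

theorem isOption_of_left {z x : Game.{u}} (h : z ∈ x.left) : IsOption z x := Or.inl h

theorem isOption_of_right {z x : Game.{u}} (h : z ∈ x.right) : IsOption z x := Or.inr h

theorem isOption_left (x : Game.{u}) (z : x.left) : IsOption z.1 x := Or.inl z.2

theorem isOption_right (x : Game.{u}) (z : x.right) : IsOption z.1 x := Or.inr z.2

/-! ### Order, days, surreal numbers -/

/-- Comparison: `x ≤ y` iff no member of `L_x` is `≥ y` and no member of `R_y` is `≤ x`
(see `Game.le_iff`). -/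
def le : Game.{u} → Game.{u} → Prop :=
  Sym2.GameAdd.recursion isOption_wf fun x y IH =>
    (∀ (l : Game.{u}) (hl : l ∈ x.left),
        ¬ IH y l (Sym2.GameAdd.snd_fst (isOption_of_left hl))) ∧
      (∀ (r : Game.{u}) (hr : r ∈ y.right),
        ¬ IH r x (Sym2.GameAdd.fst_snd (isOption_of_right hr)))

instance : LE Game.{u} := ⟨le⟩

theorem le_iff (x y : Game.{u}) :
    x ≤ y ↔ (∀ l ∈ x.left, ¬ y ≤ l) ∧ (∀ r ∈ y.right, ¬ r ≤ x) := by
  change le x y ↔ _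
  unfold le
  rw [Sym2.GameAdd.recursion_eq]
  rfl

/-- `x < y` iff `x ≤ y` and not `y ≤ x`. -/
instance : LT Game.{u} := ⟨fun x y => x ≤ y ∧ ¬ y ≤ x⟩

/-- The relation `x ≈ y`: `x ≤ y` and `y ≤ x`. -/
def Equiv (x y : Game.{u}) : Prop := x ≤ y ∧ y ≤ x

/-- `Day α`: the pairs `x` with `L_x, R_x ⊆ ⋃_{β < α} Day β` and no member of `R_x` being `≤` any
member of `L_x`. -/
def Day (α : Ordinal.{u}) : Set Game.{u} :=
  {x | x.left ⊆ ⋃ β : Set.Iio α, Day β.1 ∧ x.right ⊆ ⋃ β : Set.Iio α, Day β.1 ∧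
    ∀ l ∈ x.left, ∀ r ∈ x.right, ¬ r ≤ l}
termination_by α
decreasing_by all_goals exact β.2

/-- `x` is a surreal number: it is a member of some day. -/
def IsSurreal (x : Game.{u}) : Prop := ∃ α : Ordinal.{u}, x ∈ Day α

/-- The birthday of a surreal number. -/
noncomputable def born (x : Game.{u}) : Ordinal.{u} := sInf {α | x ∈ Day α}

/-! ### Arithmetic -/

noncomputable instance : Zero Game.{u} := ⟨ofSets ∅ ∅⟩

/-- `-x = {-x^R | -x^L}`. -/
noncomputable def neg (x : Game.{u}) : Game.{u} :=
  ofSets (Set.range fun r : x.right => neg r.1) (Set.range fun l : x.left => neg l.1)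
termination_by x
decreasing_by
  · exact isOption_right x r
  · exact isOption_left x l

noncomputable instance : Neg Game.{u} := ⟨neg⟩

/-- `x + y = {x^L + y, x + y^L | x^R + y, x + y^R}`. -/
noncomputable def add (x y : Game.{u}) : Game.{u} :=
  ofSets
    ((Set.range fun l : x.left => add l.1 y) ∪ (Set.range fun l : y.left => add x l.1))
    ((Set.range fun r : x.right => add r.1 y) ∪ (Set.range fun r : y.right => add x r.1))
termination_by (x, y)
decreasing_by
  · exact Prod.Lex.left _ _ (isOption_left x l)
  · exact Prod.Lex.right _ (isOption_left y l)
  · exact Prod.Lex.left _ _ (isOption_right x r)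
  · exact Prod.Lex.right _ (isOption_right y r)

noncomputable instance : Add Game.{u} := ⟨add⟩

noncomputable instance : Sub Game.{u} := ⟨fun x y => x + -y⟩

/-- `x · y = {x^L·y + x·y^L - x^L·y^L, x^R·y + x·y^R - x^R·y^R |
x^L·y + x·y^R - x^L·y^R, x^R·y + x·y^L - x^R·y^L}`. -/
noncomputable def mul (x y : Game.{u}) : Game.{u} :=
  ofSets
    ((Set.range fun p : x.left × y.left =>
        mul p.1.1 y + mul x p.2.1 - mul p.1.1 p.2.1) ∪
      (Set.range fun p : x.right × y.right =>
        mul p.1.1 y + mul x p.2.1 - mul p.1.1 p.2.1))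
    ((Set.range fun p : x.left × y.right =>
        mul p.1.1 y + mul x p.2.1 - mul p.1.1 p.2.1) ∪
      (Set.range fun p : x.right × y.left =>
        mul p.1.1 y + mul x p.2.1 - mul p.1.1 p.2.1))
termination_by (x, y)
decreasing_by
  · exact Prod.Lex.left _ _ (isOption_left x p.1)
  · exact Prod.Lex.right _ (isOption_left y p.2)
  · exact Prod.Lex.left _ _ (isOption_left x p.1)
  · exact Prod.Lex.left _ _ (isOption_right x p.1)
  · exact Prod.Lex.right _ (isOption_right y p.2)
  · exact Prod.Lex.left _ _ (isOption_right x p.1)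
  · exact Prod.Lex.left _ _ (isOption_left x p.1)
  · exact Prod.Lex.right _ (isOption_right y p.2)
  · exact Prod.Lex.left _ _ (isOption_left x p.1)
  · exact Prod.Lex.left _ _ (isOption_right x p.1)
  · exact Prod.Lex.right _ (isOption_left y p.2)
  · exact Prod.Lex.left _ _ (isOption_right x p.1)

noncomputable instance : Mul Game.{u} := ⟨mul⟩

open Classical in
/-- The absolute value: `x` if `0 ≤ x`, and `-x` otherwise. -/
noncomputable def absVal (x : Game.{u}) : Game.{u} := if 0 ≤ x then x else -x

/-! ### The canonical representative of a class -/

/-- The natural (Hessenberg) sum of ordinals: the least ordinal above all `a' ⊕ b`, `a' < a`, and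
all `a ⊕ b'`, `b' < b`. -/
noncomputable def hessenberg (a b : Ordinal.{v}) : Ordinal.{v} :=
  max (⨆ a' : Set.Iio a, Order.succ (hessenberg a'.1 b))
    (⨆ b' : Set.Iio b, Order.succ (hessenberg a b'.1))
termination_by (a, b)
decreasing_by
  · exact Prod.Lex.left _ _ a'.2
  · exact Prod.Lex.right _ b'.2

/-- The birthday of the youngest surreals that are `≈ x`. -/
noncomputable def bornEq (x : Game.{u}) : Ordinal.{u} :=
  sInf {α | ∃ y : Game.{u}, y.IsSurreal ∧ y.Equiv x ∧ y.born = α}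

/-- The set of the youngest surreals that are `≈ x`. -/
def bornEqSet (x : Game.{u}) : Set Game.{u} :=
  {y | y.IsSurreal ∧ y.Equiv x ∧ y.born = x.bornEq}

/-- The surreals all of whose left and right members belong to `X`. -/
def madeOf (X : Set Game.{u}) : Set Game.{u} :=
  {y | y.IsSurreal ∧ y.left ∪ y.right ⊆ X}

/-- The Hessenberg sum of the cardinalities of `L_x` and `R_x`. -/
noncomputable def cardSum (x : Game.{u}) : Ordinal.{u + 1} :=
  hessenberg (Cardinal.mk x.left).ord (Cardinal.mk x.right).ord

/-- `y` is `Y`-smallest: it is a member of `Y` with the least `cardSum`. -/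
def IsSmallest (Y : Set Game.{u}) (y : Game.{u}) : Prop :=
  y ∈ Y ∧ ∀ z ∈ Y, y.cardSum ≤ z.cardSum

/-- The global choice of a `Y`-smallest surreal. -/
noncomputable def theSmallest (Y : Set Game.{u}) : Game.{u} :=
  @Classical.epsilon Game.{u} ⟨0⟩ (IsSmallest Y)

/-- The transfinite sequence of suitably selected surreals: on day `β` it adds, for each `≈`-class
whose youngest members are born on day `β`, the globally chosen smallest one among those youngest
members that have only previously selected surreals in their left and right sets. -/
def uniqOp (β : Ordinal.{u}) : Set Game.{u} :=
  {x | (x ∈ ⋃ γ : Set.Iio β, uniqOp γ.1) ∨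
    (x.IsSurreal ∧ β = x.bornEq ∧
      (x.bornEqSet ∩ madeOf (⋃ γ : Set.Iio β, uniqOp γ.1)).Nonempty ∧
      x = theSmallest (x.bornEqSet ∩ madeOf (⋃ γ : Set.Iio β, uniqOp γ.1)))}
termination_by β
decreasing_by all_goals exact γ.2

/-- The canonical representative `Uniq x` of the `≈`-class of a surreal number `x`. -/
noncomputable def uniq (x : Game.{u}) : Game.{u} :=
  @Classical.epsilon Game.{u} ⟨0⟩ fun y => y.Equiv x ∧ y ∈ uniqOp x.bornEq

/-- `y` is a canonical surreal number (uSurreal): a value of `Uniq` at a surreal number. -/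
def IsUSurreal (y : Game.{u}) : Prop := ∃ x : Game.{u}, x.IsSurreal ∧ y = x.uniq

/-! ### Integers, dyadic numbers and reals as surreal numbers -/

/-- `n ↦ s_ℤ(n)` on `ℕ`: `0` at `0` and `{s_ℤ(n) | }` at `n + 1`. -/
noncomputable def ofNat : ℕ → Game.{u}
  | 0 => 0
  | n + 1 => ofSets {ofNat n} ∅

/-- `n ↦ s_ℤ(-n)` on `ℕ`: `0` at `0` and `{ | s_ℤ(-n)}` at `n + 1`. -/
noncomputable def ofNegNat : ℕ → Game.{u}
  | 0 => 0
  | n + 1 => ofSets ∅ {ofNegNat n}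

/-- The map `s_ℤ`. -/
noncomputable def ofInt : ℤ → Game.{u}
  | Int.ofNat n => ofNat n
  | Int.negSucc n => ofNegNat (n + 1)

/-- `ofDyadic p j` is `s_𝔻(j / 2 ^ p)`: it is `s_ℤ(j)` for `p = 0`,
`s_𝔻((2j) / 2 ^ (p + 1)) = s_𝔻(j / 2 ^ p)`, and
`s_𝔻((2j + 1) / 2 ^ (p + 1)) = {s_𝔻(j / 2 ^ p) | s_𝔻((j + 1) / 2 ^ p)}`. -/
noncomputable def ofDyadic : ℕ → ℤ → Game.{u}
  | 0, j => ofInt j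
  | p + 1, m =>
    if Even m then ofDyadic p (m / 2)
    else ofSets {ofDyadic p (m / 2)} {ofDyadic p (m / 2 + 1)}

/-- The map `s_ℝ`: the canonical representative of the class of
`{s_𝔻(⌈r 2^n - 1⌉ / 2^n) | s_𝔻(⌊r 2^n + 1⌋ / 2^n)}_{n ∈ ℕ}`. -/
noncomputable def ofReal (r : ℝ) : Game.{u} :=
  uniq (ofSets (Set.range fun n : ℕ => ofDyadic n ⌈r * 2 ^ n - 1⌉)
    (Set.range fun n : ℕ => ofDyadic n ⌊r * 2 ^ n + 1⌋))

/-! ### Commensurability and powers of `ω` -/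

/-- `x`, `y` are commensurate: `x < s_ℤ(n)·y` and `y < s_ℤ(m)·x` for some natural `n`, `m`. -/
def Commensurate (x y : Game.{u}) : Prop :=
  (∃ n : ℕ, x < ofInt (n : ℤ) * y) ∧ (∃ m : ℕ, y < ofInt (m : ℤ) * x)

/-- `x` is infinitely less than `y`: `x·s_ℤ(n) < y` for all positive natural `n`. -/
def InfinitelyLess (x y : Game.{u}) : Prop :=
  ∀ n : ℕ, n ≠ 0 → x * ofInt (n : ℤ) < y

/-- `ω^x = {0, s_ℝ(r)·ω^{x^L} | s_ℝ(s)·ω^{x^R}}` with `r`, `s` ranging over the positive reals. -/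
noncomputable def omegaPow (x : Game.{u}) : Game.{u} :=
  ofSets
    ({0} ∪ Set.range fun p : Set.Ioi (0 : ℝ) × x.left => ofReal p.1.1 * omegaPow p.2.1)
    (Set.range fun p : Set.Ioi (0 : ℝ) × x.right => ofReal p.1.1 * omegaPow p.2.1)
termination_by x
decreasing_by
  · exact isOption_left x p.2
  · exact isOption_right x p.2

end Game

namespace Game

/-! ### The preorder of games -/

/-! Comparisons take place among values: games modulo `≈` form an ordered abelian group `Value`, and
the values of surreals form a linearly ordered subgroup of it. Products of surreals are surreal and
respect both `≈` and the order (`mul_induction`). Hence each positive surreal `w` gives a strictly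
increasing additive map `r ↦ s_ℝ(r)·w` from the reals (`IsSurreal.realMul`). About `s_ℝ` this needs
only additivity, monotonicity and `s_ℝ(1) ≈ 1`; its multiplicativity plays no role.

The powers `ω^y` are positive surreals, and `y < z` puts every real multiple of `ω^y` below every
positive real multiple of `ω^z` (`omegaPow_induction`). Powers with inequivalent exponents are
therefore never commensurate.

Every positive `x` is commensurate with some `ω^y` (`exists_omegaPow_boundedBy`), by induction on
`x`. If `x` is commensurate with one of its positive options, the exponent of that option serves.
Otherwise its positive left options are infinitely below it and its right options infinitely above
it; the exponents attached to these options form a cut `y`, and `ω^y ≈ x`.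

When `|x|` is commensurate with `ω^y`, the coefficient is the supremum of the reals `r` with
`s_ℝ(r)·ω^y ≤ |x|`, up to the sign of `x` (`exists_leading_coeff`). Conversely, a nonzero
coefficient with an infinitely smaller remainder forces commensurability
(`commensurate_of_leading_coeff`). Two leaders of `x` are then commensurate with each other, so
their exponents are equivalent, and equivalent canonical surreals are equal
(`IsUSurreal.eq_of_equiv`). -/

theorem le_refl' (x : Game.{u}) : x ≤ x := by
  rw [le_iff]
  exact ⟨fun l hl h => ((le_iff x l).1 h).1 l hl (le_refl' l),
    fun r hr h => ((le_iff r x).1 h).2 r hr (le_refl' r)⟩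
termination_by x
decreasing_by
  · exact isOption_of_left hl
  · exact isOption_of_right hr

theorem le_trans_of_options {x y z : Game.{u}} (hx : ∀ l ∈ x.left, y ≤ z → z ≤ l → y ≤ l)
    (hz : ∀ r ∈ z.right, r ≤ x → x ≤ y → r ≤ y) (hxy : x ≤ y) (hyz : y ≤ z) : x ≤ z := by
  rw [le_iff]
  exact ⟨fun l hl h => ((le_iff x y).1 hxy).1 l hl (hx l hl hyz h),
    fun r hr h => ((le_iff y z).1 hyz).2 r hr (hz r hr h hxy)⟩

/-- Replacing one game by an option rotates the roles of the three games, so transitivity for one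
order of the triple needs the induction hypothesis for another. The three cyclic forms are closed
under this. -/
theorem le_trans_cyclic (x y z : Game.{u}) :
    (x ≤ y → y ≤ z → x ≤ z) ∧ (y ≤ z → z ≤ x → y ≤ x) ∧ (z ≤ x → x ≤ y → z ≤ y) := by
  refine ⟨le_trans_of_options (fun l hl => (le_trans_cyclic l y z).2.1)
      (fun r hr => (le_trans_cyclic x y r).2.2),
    le_trans_of_options (fun l hl => (le_trans_cyclic x l z).2.2)
      (fun r hr => (le_trans_cyclic r y z).1),
    le_trans_of_options (fun l hl => (le_trans_cyclic x y l).1)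
      (fun r hr => (le_trans_cyclic x r z).2.1)⟩
termination_by (x, y, z)
decreasing_by
  · exact Prod.Lex.left _ _ (isOption_of_left hl)
  · exact Prod.Lex.right _ (Prod.Lex.right _ (isOption_of_right hr))
  · exact Prod.Lex.right _ (Prod.Lex.left _ _ (isOption_of_left hl))
  · exact Prod.Lex.left _ _ (isOption_of_right hr)
  · exact Prod.Lex.right _ (Prod.Lex.right _ (isOption_of_left hl))
  · exact Prod.Lex.right _ (Prod.Lex.left _ _ (isOption_of_right hr))

instance : Preorder Game.{u} where
  le_refl := le_refl'
  le_trans x y z := (le_trans_cyclic x y z).1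
  lt_iff_le_not_ge _ _ := Iff.rfl

/-- For surreals `x < y` this interpolates an option between `x` and `y`. The monotonicity proofs
for products and for powers of `ω` all split a strict inequality at such an option. -/
theorem not_le_iff {x y : Game.{u}} :
    ¬ y ≤ x ↔ (∃ l ∈ y.left, x ≤ l) ∨ ∃ r ∈ x.right, r ≤ y := by
  rw [le_iff y x]
  push Not
  rw [or_iff_not_imp_left]
  push Not
  rfl

theorem not_le_left {x l : Game.{u}} (h : l ∈ x.left) : ¬ x ≤ l :=
  ((le_iff x x).1 le_rfl).1 l h

theorem not_right_le {x r : Game.{u}} (h : r ∈ x.right) : ¬ r ≤ x :=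
  ((le_iff x x).1 le_rfl).2 r h

theorem le_of_options {x y : Game.{u}} (hL : ∀ l ∈ x.left, ∃ l' ∈ y.left, l ≤ l')
    (hR : ∀ r ∈ y.right, ∃ r' ∈ x.right, r' ≤ r) : x ≤ y := by
  rw [le_iff]
  constructor
  · intro l hl h
    obtain ⟨l', hl', hle⟩ := hL l hl
    exact not_le_left hl' (h.trans hle)
  · intro r hr h
    obtain ⟨r', hr', hle⟩ := hR r hr
    exact not_right_le hr' (hle.trans h)

theorem Equiv.refl (x : Game.{u}) : x.Equiv x := ⟨le_rfl, le_rfl⟩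

theorem Equiv.symm {x y : Game.{u}} (h : x.Equiv y) : y.Equiv x := ⟨h.2, h.1⟩

theorem Equiv.trans {x y z : Game.{u}} (h : x.Equiv y) (h' : y.Equiv z) : x.Equiv z :=
  ⟨h.1.trans h'.1, h'.2.trans h.2⟩

/-! ### Negation and addition -/

@[simp]
theorem left_zero : (0 : Game.{u}).left = ∅ := left_ofSets ∅ ∅

@[simp]
theorem right_zero : (0 : Game.{u}).right = ∅ := right_ofSets ∅ ∅

theorem left_neg (x : Game.{u}) : (-x).left = Neg.neg '' x.right := by
  change (neg x).left = _
  rw [neg, left_ofSets, Set.image_eq_range]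
  rfl

theorem right_neg (x : Game.{u}) : (-x).right = Neg.neg '' x.left := by
  change (neg x).right = _
  rw [neg, right_ofSets, Set.image_eq_range]
  rfl

theorem left_add (x y : Game.{u}) :
    (x + y).left = (fun l => l + y) '' x.left ∪ (fun l => x + l) '' y.left := by
  change (add x y).left = _
  rw [add, left_ofSets, Set.image_eq_range, Set.image_eq_range]
  rfl

theorem right_add (x y : Game.{u}) :
    (x + y).right = (fun r => r + y) '' x.right ∪ (fun r => x + r) '' y.right := by
  change (add x y).right = _
  rw [add, right_ofSets, Set.image_eq_range, Set.image_eq_range]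
  rfl

theorem sub_def (x y : Game.{u}) : x - y = x + -y := rfl

theorem neg_neg' (x : Game.{u}) : - -x = x := by
  ext z
  · rw [left_neg, right_neg, Set.image_image]
    exact ⟨by rintro ⟨l, hl, rfl⟩; change - -l ∈ _; rwa [neg_neg' l], fun hl => ⟨z, hl, neg_neg' z⟩⟩
  · rw [right_neg, left_neg, Set.image_image]
    exact ⟨by rintro ⟨l, hl, rfl⟩; change - -l ∈ _; rwa [neg_neg' l], fun hl => ⟨z, hl, neg_neg' z⟩⟩
termination_by x
decreasing_by
  all_goals first | exact isOption_of_left hl | exact isOption_of_right hl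

theorem neg_mem_left_neg {x r : Game.{u}} (h : r ∈ x.right) : -r ∈ (-x).left := by
  rw [left_neg]; exact ⟨r, h, rfl⟩

theorem neg_mem_right_neg {x l : Game.{u}} (h : l ∈ x.left) : -l ∈ (-x).right := by
  rw [right_neg]; exact ⟨l, h, rfl⟩

theorem add_comm' (x y : Game.{u}) : x + y = y + x := by
  have h1 : ∀ l ∈ x.left, l + y = y + l := fun l hl => add_comm' l y
  have h2 : ∀ l ∈ y.left, x + l = l + x := fun l hl => add_comm' x l
  have h3 : ∀ l ∈ x.right, l + y = y + l := fun l hl => add_comm' l y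
  have h4 : ∀ l ∈ y.right, x + l = l + x := fun l hl => add_comm' x l
  ext1
  · rw [left_add, left_add, Set.union_comm, Set.image_congr h1, Set.image_congr h2]
  · rw [right_add, right_add, Set.union_comm, Set.image_congr h3, Set.image_congr h4]
termination_by (x, y)
decreasing_by
  · exact Prod.Lex.left _ _ (isOption_of_left hl)
  · exact Prod.Lex.right _ (isOption_of_left hl)
  · exact Prod.Lex.left _ _ (isOption_of_right hl)
  · exact Prod.Lex.right _ (isOption_of_right hl)

theorem add_zero' (x : Game.{u}) : x + 0 = x := by
  have h1 : ∀ l ∈ x.left, l + 0 = l := fun l hl => add_zero' l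
  have h2 : ∀ l ∈ x.right, l + 0 = l := fun l hl => add_zero' l
  ext1
  · rw [left_add, Set.image_congr h1]; simp
  · rw [right_add, Set.image_congr h2]; simp
termination_by x
decreasing_by
  · exact isOption_of_left hl
  · exact isOption_of_right hl

theorem add_assoc' (x y z : Game.{u}) : x + y + z = x + (y + z) := by
  have h1 : ∀ l ∈ x.left, l + y + z = l + (y + z) := fun l hl => add_assoc' l y z
  have h2 : ∀ l ∈ y.left, x + l + z = x + (l + z) := fun l hl => add_assoc' x l z
  have h3 : ∀ l ∈ z.left, x + y + l = x + (y + l) := fun l hl => add_assoc' x y l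
  have h4 : ∀ l ∈ x.right, l + y + z = l + (y + z) := fun l hl => add_assoc' l y z
  have h5 : ∀ l ∈ y.right, x + l + z = x + (l + z) := fun l hl => add_assoc' x l z
  have h6 : ∀ l ∈ z.right, x + y + l = x + (y + l) := fun l hl => add_assoc' x y l
  ext1
  · simp only [left_add, Set.image_union, Set.image_image]
    rw [Set.image_congr h1, Set.image_congr h2, Set.image_congr h3, Set.union_assoc]
  · simp only [right_add, Set.image_union, Set.image_image]
    rw [Set.image_congr h4, Set.image_congr h5, Set.image_congr h6, Set.union_assoc]
termination_by (x, y, z)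
decreasing_by
  · exact Prod.Lex.left _ _ (isOption_of_left hl)
  · exact Prod.Lex.right _ (Prod.Lex.left _ _ (isOption_of_left hl))
  · exact Prod.Lex.right _ (Prod.Lex.right _ (isOption_of_left hl))
  · exact Prod.Lex.left _ _ (isOption_of_right hl)
  · exact Prod.Lex.right _ (Prod.Lex.left _ _ (isOption_of_right hl))
  · exact Prod.Lex.right _ (Prod.Lex.right _ (isOption_of_right hl))

theorem neg_add' (x y : Game.{u}) : -(x + y) = -x + -y := by
  have h1 : ∀ l ∈ x.left, -(l + y) = -l + -y := fun l hl => neg_add' l y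
  have h2 : ∀ l ∈ y.left, -(x + l) = -x + -l := fun l hl => neg_add' x l
  have h3 : ∀ l ∈ x.right, -(l + y) = -l + -y := fun l hl => neg_add' l y
  have h4 : ∀ l ∈ y.right, -(x + l) = -x + -l := fun l hl => neg_add' x l
  ext1
  · simp only [left_add, right_add, left_neg, Set.image_union, Set.image_image]
    rw [Set.image_congr h3, Set.image_congr h4]
  · simp only [left_add, right_add, right_neg, Set.image_union, Set.image_image]
    rw [Set.image_congr h1, Set.image_congr h2]
termination_by (x, y)
decreasing_by
  · exact Prod.Lex.left _ _ (isOption_of_left hl)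
  · exact Prod.Lex.right _ (isOption_of_left hl)
  · exact Prod.Lex.left _ _ (isOption_of_right hl)
  · exact Prod.Lex.right _ (isOption_of_right hl)

/-- The mirror strategy: a move in one summand is answered by the negated move in the other, which
leaves `o + -o` for an option `o` of `x`. -/
theorem add_neg_equiv_zero (x : Game.{u}) : (x + -x).Equiv 0 := by
  have h1 : ∀ l ∈ x.left, (l + -l).Equiv 0 := fun l hl => add_neg_equiv_zero l
  have h2 : ∀ r ∈ x.right, (r + -r).Equiv 0 := fun l hl => add_neg_equiv_zero l
  constructor
  · rw [le_iff]
    refine ⟨?_, by simp⟩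
    rw [left_add]
    rintro _ (⟨l, hl, rfl⟩ | ⟨_, hr, rfl⟩) h
    · refine ((le_iff _ _).1 h).2 (l + -l) ?_ (h1 l hl).1
      rw [right_add]
      exact Or.inr ⟨_, neg_mem_right_neg hl, rfl⟩
    · rw [left_neg] at hr
      obtain ⟨r, hr, rfl⟩ := hr
      refine ((le_iff _ _).1 h).2 (r + -r) ?_ (h2 r hr).1
      rw [right_add]
      exact Or.inl ⟨_, hr, rfl⟩
  · rw [le_iff]
    refine ⟨by simp, ?_⟩
    rw [right_add]
    rintro _ (⟨r, hr, rfl⟩ | ⟨_, hl, rfl⟩) h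
    · refine ((le_iff _ _).1 h).1 (r + -r) ?_ (h2 r hr).2
      rw [left_add]
      exact Or.inr ⟨_, neg_mem_left_neg hr, rfl⟩
    · rw [right_neg] at hl
      obtain ⟨l, hl, rfl⟩ := hl
      refine ((le_iff _ _).1 h).1 (l + -l) ?_ (h1 l hl).2
      rw [left_add]
      exact Or.inl ⟨_, hl, rfl⟩
termination_by x
decreasing_by
  · exact isOption_of_left hl
  · exact isOption_of_right hl

theorem add_le_add_right_aux {a b z : Game.{u}}
    (ha : ∀ o, IsOption o a → (b + z ≤ o + z ↔ b ≤ o))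
    (hb : ∀ o, IsOption o b → (o + z ≤ a + z ↔ o ≤ a))
    (hz : ∀ o, IsOption o z → (a + o ≤ b + o ↔ a ≤ b)) : a + z ≤ b + z ↔ a ≤ b := by
  constructor
  · intro h
    rw [le_iff] at h ⊢
    refine ⟨fun l hl h' => h.1 (l + z) ?_ ((ha l (Or.inl hl)).2 h'),
      fun r hr h' => h.2 (r + z) ?_ ((hb r (Or.inr hr)).2 h')⟩
    · rw [left_add]; exact Or.inl ⟨l, hl, rfl⟩
    · rw [right_add]; exact Or.inl ⟨r, hr, rfl⟩
  · intro h
    have h0 := (le_iff a b).1 h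
    rw [le_iff, left_add, right_add]
    constructor
    · rintro _ (⟨l, hl, rfl⟩ | ⟨l, hl, rfl⟩) h'
      · exact h0.1 l hl ((ha l (Or.inl hl)).1 h')
      · refine not_le_left (l := b + l) ?_ (h'.trans ((hz l (Or.inl hl)).2 h))
        rw [left_add]; exact Or.inr ⟨l, hl, rfl⟩
    · rintro _ (⟨r, hr, rfl⟩ | ⟨r, hr, rfl⟩) h'
      · exact h0.2 r hr ((hb r (Or.inr hr)).1 h')
      · refine not_right_le (r := a + r) ?_ (((hz r (Or.inr hr)).2 h).trans h')
        rw [right_add]; exact Or.inr ⟨r, hr, rfl⟩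

/-- Unfolding `≤` at an option reverses the comparison, so both directions are carried through one
induction. -/
theorem add_le_add_right_and (x y z : Game.{u}) :
    (x + z ≤ y + z ↔ x ≤ y) ∧ (y + z ≤ x + z ↔ y ≤ x) := by
  have hx : ∀ o, IsOption o x → (o + z ≤ y + z ↔ o ≤ y) ∧ (y + z ≤ o + z ↔ y ≤ o) :=
    fun o ho => add_le_add_right_and o y z
  have hy : ∀ o, IsOption o y → (x + z ≤ o + z ↔ x ≤ o) ∧ (o + z ≤ x + z ↔ o ≤ x) :=
    fun o ho => add_le_add_right_and x o z
  have hz : ∀ o, IsOption o z → (x + o ≤ y + o ↔ x ≤ y) ∧ (y + o ≤ x + o ↔ y ≤ x) :=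
    fun o ho => add_le_add_right_and x y o
  exact ⟨add_le_add_right_aux (fun o ho => (hx o ho).2) (fun o ho => (hy o ho).2)
      fun o ho => (hz o ho).1,
    add_le_add_right_aux (fun o ho => (hy o ho).1) (fun o ho => (hx o ho).1)
      fun o ho => (hz o ho).2⟩
termination_by (x, y, z)
decreasing_by
  · exact Prod.Lex.left _ _ ho
  · exact Prod.Lex.right _ (Prod.Lex.left _ _ ho)
  · exact Prod.Lex.right _ (Prod.Lex.right _ ho)

theorem add_le_add_iff_right' {x y : Game.{u}} (z : Game.{u}) : x + z ≤ y + z ↔ x ≤ y :=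
  (add_le_add_right_and x y z).1

theorem add_le_add' {x y z w : Game.{u}} (h : x ≤ y) (h' : z ≤ w) : x + z ≤ y + w := by
  refine ((add_le_add_iff_right' z).2 h).trans ?_
  rw [add_comm' y z, add_comm' y w]
  exact (add_le_add_iff_right' y).2 h'

theorem neg_le_neg' {x y : Game.{u}} (h : x ≤ y) : -y ≤ -x := by
  have h1 : -y ≤ x + -x + -y := by
    conv_lhs => rw [← add_zero' (-y), add_comm']
    exact (add_le_add_iff_right' _).2 (add_neg_equiv_zero x).2
  have h2 : x + -x + -y ≤ y + -x + -y := add_le_add' (add_le_add' h le_rfl) le_rfl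
  have h3 : y + -x + -y ≤ -x := by
    conv_rhs => rw [← add_zero' (-x)]
    rw [add_comm' y, add_assoc']
    exact add_le_add' le_rfl (add_neg_equiv_zero y).1
  exact h1.trans (h2.trans h3)

/-! ### The ordered group of values of games -/

/-- Games up to `≈`. -/
def Value : Type (u + 1) := Antisymmetrization Game.{u} (· ≤ ·)

noncomputable instance : PartialOrder Value.{u} :=
  inferInstanceAs (PartialOrder (Antisymmetrization Game.{u} (· ≤ ·)))

/-- The `≈`-class of a game. -/
def val (x : Game.{u}) : Value.{u} := toAntisymmetrization (· ≤ ·) x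

theorem val_le_val {x y : Game.{u}} : x.val ≤ y.val ↔ x ≤ y :=
  toAntisymmetrization_le_toAntisymmetrization_iff

theorem val_lt_val {x y : Game.{u}} : x.val < y.val ↔ x < y :=
  toAntisymmetrization_lt_toAntisymmetrization_iff

theorem val_eq_val {x y : Game.{u}} : x.val = y.val ↔ x.Equiv y := by
  rw [le_antisymm_iff, val_le_val, val_le_val]; rfl

noncomputable instance : Add Value.{u} :=
  ⟨Quotient.map₂ (· + ·) fun _ _ h _ _ h' => ⟨add_le_add' h.1 h'.1, add_le_add' h.2 h'.2⟩⟩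

noncomputable instance : Zero Value.{u} := ⟨val 0⟩

noncomputable instance : Neg Value.{u} :=
  ⟨Quotient.map (- ·) fun _ _ h => ⟨neg_le_neg' h.2, neg_le_neg' h.1⟩⟩

noncomputable instance : AddCommGroup Value.{u} where
  add_assoc := by
    rintro ⟨x⟩ ⟨y⟩ ⟨z⟩
    exact congrArg val (add_assoc' x y z)
  zero_add := by
    rintro ⟨x⟩
    exact congrArg val ((add_comm' 0 x).trans (add_zero' x))
  add_zero := by
    rintro ⟨x⟩
    exact congrArg val (add_zero' x)
  neg_add_cancel := by
    rintro ⟨x⟩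
    exact (congrArg val (add_comm' (-x) x)).trans (val_eq_val.2 (add_neg_equiv_zero x))
  add_comm := by
    rintro ⟨x⟩ ⟨y⟩
    exact congrArg val (add_comm' x y)
  nsmul := nsmulRec
  zsmul := zsmulRec

@[simp]
theorem val_zero : (0 : Game.{u}).val = 0 := rfl

@[simp]
theorem val_add (x y : Game.{u}) : (x + y).val = x.val + y.val := rfl

@[simp]
theorem val_neg (x : Game.{u}) : (-x).val = -x.val := rfl

@[simp]
theorem val_sub (x y : Game.{u}) : (x - y).val = x.val - y.val :=
  (sub_eq_add_neg x.val y.val).symm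

instance : IsOrderedAddMonoid Value.{u} where
  add_le_add_left := by
    rintro ⟨x⟩ ⟨y⟩ h ⟨z⟩
    exact add_le_add' h le_rfl

/-! ### Surreal numbers -/

theorem mem_day_iff {α : Ordinal.{u}} {x : Game.{u}} :
    x ∈ Day α ↔ (∀ l ∈ x.left, ∃ β < α, l ∈ Day β) ∧ (∀ r ∈ x.right, ∃ β < α, r ∈ Day β) ∧
      ∀ l ∈ x.left, ∀ r ∈ x.right, ¬ r ≤ l := by
  rw [Day]
  simp [Set.subset_def]

theorem day_mono {α β : Ordinal.{u}} (h : α ≤ β) : Day α ⊆ Day β := by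
  intro x hx
  rw [mem_day_iff] at hx ⊢
  refine ⟨fun l hl => ?_, fun r hr => ?_, hx.2.2⟩
  · obtain ⟨γ, hγ, h'⟩ := hx.1 l hl
    exact ⟨γ, hγ.trans_le h, h'⟩
  · obtain ⟨γ, hγ, h'⟩ := hx.2.1 r hr
    exact ⟨γ, hγ.trans_le h, h'⟩

/-- This eliminates the days from the definition. For the converse, the days of the options are
bounded because the option sets are small. -/
theorem isSurreal_iff {x : Game.{u}} :
    x.IsSurreal ↔ (∀ l ∈ x.left, l.IsSurreal) ∧ (∀ r ∈ x.right, r.IsSurreal) ∧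
      ∀ l ∈ x.left, ∀ r ∈ x.right, ¬ r ≤ l := by
  constructor
  · rintro ⟨α, h⟩
    rw [mem_day_iff] at h
    exact ⟨fun l hl => (h.1 l hl).imp fun _ h => h.2, fun l hl => (h.2.1 l hl).imp fun _ h => h.2,
      h.2.2⟩
  · rintro ⟨hL, hR, h⟩
    choose f hf using hL
    choose g hg using hR
    obtain ⟨a, ha⟩ := Ordinal.bddAbove_of_small
      (s := Set.range fun l : x.left => Order.succ (f l.1 l.2))
    obtain ⟨b, hb⟩ := Ordinal.bddAbove_of_small
      (s := Set.range fun r : x.right => Order.succ (g r.1 r.2))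
    refine ⟨max a b, mem_day_iff.2 ⟨fun l hl => ⟨f l hl, ?_, hf l hl⟩,
      fun r hr => ⟨g r hr, ?_, hg r hr⟩, h⟩⟩
    · exact (Order.succ_le_iff.1 (ha ⟨⟨l, hl⟩, rfl⟩)).trans_le (le_max_left _ _)
    · exact (Order.succ_le_iff.1 (hb ⟨⟨r, hr⟩, rfl⟩)).trans_le (le_max_right _ _)

theorem IsSurreal.of_left {x l : Game.{u}} (h : x.IsSurreal) (hl : l ∈ x.left) : l.IsSurreal :=
  (isSurreal_iff.1 h).1 l hl

theorem IsSurreal.of_right {x r : Game.{u}} (h : x.IsSurreal) (hr : r ∈ x.right) : r.IsSurreal :=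
  (isSurreal_iff.1 h).2.1 r hr

theorem IsSurreal.of_isOption {x o : Game.{u}} (h : x.IsSurreal) (ho : IsOption o x) :
    o.IsSurreal :=
  ho.elim h.of_left h.of_right

theorem IsSurreal.left_le_and_le_right {x : Game.{u}} (hx : x.IsSurreal) :
    (∀ l ∈ x.left, l ≤ x) ∧ ∀ r ∈ x.right, x ≤ r := by
  have hl : ∀ l ∈ x.left, (∀ l' ∈ l.left, l' ≤ l) ∧ ∀ r ∈ l.right, l ≤ r :=
    fun l hl => (hx.of_left hl).left_le_and_le_right
  have hr : ∀ l ∈ x.right, (∀ l' ∈ l.left, l' ≤ l) ∧ ∀ r ∈ l.right, l ≤ r :=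
    fun l hl => (hx.of_right hl).left_le_and_le_right
  have h := (isSurreal_iff.1 hx).2.2
  constructor
  · intro l hl'
    rw [le_iff]
    exact ⟨fun l' hl'' h' => not_le_left hl' (h'.trans ((hl l hl').1 l' hl'')),
      fun r hr' => h l hl' r hr'⟩
  · intro r hr'
    rw [le_iff]
    exact ⟨fun l hl' => h l hl' r hr',
      fun l' hl'' h' => not_right_le hr' (((hr r hr').2 l' hl'').trans h')⟩
termination_by x
decreasing_by
  · exact isOption_of_left hl
  · exact isOption_of_right hl

theorem IsSurreal.left_lt {x l : Game.{u}} (hx : x.IsSurreal) (hl : l ∈ x.left) : l < x :=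
  ⟨hx.left_le_and_le_right.1 l hl, not_le_left hl⟩

theorem IsSurreal.lt_right {x r : Game.{u}} (hx : x.IsSurreal) (hr : r ∈ x.right) : x < r :=
  ⟨hx.left_le_and_le_right.2 r hr, not_right_le hr⟩

theorem IsSurreal.le_of_not_le {x y : Game.{u}} (hx : x.IsSurreal) (hy : y.IsSurreal)
    (h : ¬ y ≤ x) : x ≤ y := by
  rw [not_le_iff] at h
  rcases h with ⟨l, hl, h⟩ | ⟨r, hr, h⟩
  · exact h.trans (hy.left_lt hl).le
  · exact (hx.lt_right hr).le.trans h

theorem IsSurreal.lt_iff_not_le {x y : Game.{u}} (hx : x.IsSurreal) (hy : y.IsSurreal) :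
    x < y ↔ ¬ y ≤ x :=
  ⟨fun h => h.2, fun h => ⟨hx.le_of_not_le hy h, h⟩⟩

theorem IsSurreal.le_iff_lt {x y : Game.{u}} (hx : x.IsSurreal) (hy : y.IsSurreal) :
    x ≤ y ↔ (∀ l ∈ x.left, l < y) ∧ ∀ r ∈ y.right, x < r := by
  rw [le_iff]
  refine and_congr (forall₂_congr fun l hl => ?_) (forall₂_congr fun r hr => ?_)
  · rw [(hx.of_left hl).lt_iff_not_le hy]
  · rw [hx.lt_iff_not_le (hy.of_right hr)]

theorem isSurreal_of_lt {x : Game.{u}} (hL : ∀ l ∈ x.left, l.IsSurreal)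
    (hR : ∀ r ∈ x.right, r.IsSurreal) (h : ∀ l ∈ x.left, ∀ r ∈ x.right, l < r) : x.IsSurreal :=
  isSurreal_iff.2 ⟨hL, hR, fun l hl r hr => (h l hl r hr).2⟩

theorem isSurreal_zero : (0 : Game.{u}).IsSurreal := isSurreal_of_lt (by simp) (by simp) (by simp)

theorem IsSurreal.neg {x : Game.{u}} (hx : x.IsSurreal) : (-x).IsSurreal := by
  have hl : ∀ l ∈ x.left, (-l).IsSurreal := fun l hl => (hx.of_left hl).neg
  have hr : ∀ l ∈ x.right, (-l).IsSurreal := fun l hl => (hx.of_right hl).neg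
  apply isSurreal_of_lt
  · rw [left_neg]; rintro _ ⟨r, h, rfl⟩; exact hr r h
  · rw [right_neg]; rintro _ ⟨r, h, rfl⟩; exact hl r h
  · rw [left_neg, right_neg]
    rintro _ ⟨r, h, rfl⟩ _ ⟨l, h', rfl⟩
    rw [← val_lt_val, val_neg, val_neg, neg_lt_neg_iff, val_lt_val]
    exact (hx.left_lt h').trans (hx.lt_right h)
termination_by x
decreasing_by
  · exact isOption_of_left hl
  · exact isOption_of_right hl

theorem IsSurreal.add {x y : Game.{u}} (hx : x.IsSurreal) (hy : y.IsSurreal) :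
    (x + y).IsSurreal := by
  have h1 : ∀ l ∈ x.left, (l + y).IsSurreal := fun l hl => (hx.of_left hl).add hy
  have h2 : ∀ l ∈ y.left, (x + l).IsSurreal := fun l hl => hx.add (hy.of_left hl)
  have h3 : ∀ l ∈ x.right, (l + y).IsSurreal := fun l hl => (hx.of_right hl).add hy
  have h4 : ∀ l ∈ y.right, (x + l).IsSurreal := fun l hl => hx.add (hy.of_right hl)
  have hlt : (∀ l ∈ (x + y).left, l.val < (x + y).val) ∧
      ∀ r ∈ (x + y).right, (x + y).val < r.val := by
    rw [left_add, right_add]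
    refine ⟨?_, ?_⟩
    · rintro _ (⟨l, hl, rfl⟩ | ⟨l, hl, rfl⟩)
      · simpa [val_lt_val] using hx.left_lt hl
      · simpa [val_lt_val] using hy.left_lt hl
    · rintro _ (⟨l, hl, rfl⟩ | ⟨l, hl, rfl⟩)
      · simpa [val_lt_val] using hx.lt_right hl
      · simpa [val_lt_val] using hy.lt_right hl
  apply isSurreal_of_lt
  · rw [left_add]
    rintro _ (⟨l, hl, rfl⟩ | ⟨l, hl, rfl⟩)
    exacts [h1 l hl, h2 l hl]
  · rw [right_add]
    rintro _ (⟨l, hl, rfl⟩ | ⟨l, hl, rfl⟩)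
    exacts [h3 l hl, h4 l hl]
  · exact fun l hl r hr => val_lt_val.1 ((hlt.1 l hl).trans (hlt.2 r hr))
termination_by (x, y)
decreasing_by
  · exact Prod.Lex.left _ _ (isOption_of_left hl)
  · exact Prod.Lex.right _ (isOption_of_left hl)
  · exact Prod.Lex.left _ _ (isOption_of_right hl)
  · exact Prod.Lex.right _ (isOption_of_right hl)

theorem IsSurreal.sub {x y : Game.{u}} (hx : x.IsSurreal) (hy : y.IsSurreal) :
    (x - y).IsSurreal :=
  hx.add hy.neg

/-! ### Multiplication -/

theorem mem_left_mul {x y z : Game.{u}} : z ∈ (x * y).left ↔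
    (∃ a ∈ x.left, ∃ b ∈ y.left, a * y + x * b - a * b = z) ∨
      ∃ a ∈ x.right, ∃ b ∈ y.right, a * y + x * b - a * b = z := by
  change z ∈ (mul x y).left ↔ _
  rw [mul, left_ofSets]
  simp only [Set.mem_union, Set.mem_range, Prod.exists, Subtype.exists]
  exact or_congr
    ⟨fun ⟨a, ha, b, hb, h⟩ => ⟨a, ha, b, hb, h⟩, fun ⟨a, ha, b, hb, h⟩ => ⟨a, ha, b, hb, h⟩⟩
    ⟨fun ⟨a, ha, b, hb, h⟩ => ⟨a, ha, b, hb, h⟩, fun ⟨a, ha, b, hb, h⟩ => ⟨a, ha, b, hb, h⟩⟩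

theorem mem_right_mul {x y z : Game.{u}} : z ∈ (x * y).right ↔
    (∃ a ∈ x.left, ∃ b ∈ y.right, a * y + x * b - a * b = z) ∨
      ∃ a ∈ x.right, ∃ b ∈ y.left, a * y + x * b - a * b = z := by
  change z ∈ (mul x y).right ↔ _
  rw [mul, right_ofSets]
  simp only [Set.mem_union, Set.mem_range, Prod.exists, Subtype.exists]
  exact or_congr
    ⟨fun ⟨a, ha, b, hb, h⟩ => ⟨a, ha, b, hb, h⟩, fun ⟨a, ha, b, hb, h⟩ => ⟨a, ha, b, hb, h⟩⟩
    ⟨fun ⟨a, ha, b, hb, h⟩ => ⟨a, ha, b, hb, h⟩, fun ⟨a, ha, b, hb, h⟩ => ⟨a, ha, b, hb, h⟩⟩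

theorem neg_zero' : -(0 : Game.{u}) = 0 := by
  ext1 <;> simp [left_neg, right_neg]

theorem mul_zero' (x : Game.{u}) : x * 0 = 0 := by
  ext z <;> simp [mem_left_mul, mem_right_mul]

theorem mul_comm' (x y : Game.{u}) : x * y = y * x := by
  have hx : ∀ a, IsOption a x → a * y = y * a := fun a ha => mul_comm' a y
  have hy : ∀ b, IsOption b y → x * b = b * x := fun b hb => mul_comm' x b
  have hxy : ∀ a, IsOption a x → ∀ b, IsOption b y → a * b = b * a :=
    fun a ha b hb => mul_comm' a b
  have key : ∀ a, IsOption a x → ∀ b, IsOption b y →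
      a * y + x * b - a * b = b * x + y * a - b * a := by
    intro a ha b hb
    rw [hx a ha, hy b hb, hxy a ha b hb, add_comm']
  ext z
  · rw [mem_left_mul, mem_left_mul]
    constructor
    · rintro (⟨a, ha, b, hb, rfl⟩ | ⟨a, ha, b, hb, rfl⟩)
      · exact Or.inl ⟨b, hb, a, ha, (key a (Or.inl ha) b (Or.inl hb)).symm⟩
      · exact Or.inr ⟨b, hb, a, ha, (key a (Or.inr ha) b (Or.inr hb)).symm⟩
    · rintro (⟨b, hb, a, ha, rfl⟩ | ⟨b, hb, a, ha, rfl⟩)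
      · exact Or.inl ⟨a, ha, b, hb, key a (Or.inl ha) b (Or.inl hb)⟩
      · exact Or.inr ⟨a, ha, b, hb, key a (Or.inr ha) b (Or.inr hb)⟩
  · rw [mem_right_mul, mem_right_mul]
    constructor
    · rintro (⟨a, ha, b, hb, rfl⟩ | ⟨a, ha, b, hb, rfl⟩)
      · exact Or.inr ⟨b, hb, a, ha, (key a (Or.inl ha) b (Or.inr hb)).symm⟩
      · exact Or.inl ⟨b, hb, a, ha, (key a (Or.inr ha) b (Or.inl hb)).symm⟩
    · rintro (⟨b, hb, a, ha, rfl⟩ | ⟨b, hb, a, ha, rfl⟩)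
      · exact Or.inr ⟨a, ha, b, hb, key a (Or.inr ha) b (Or.inl hb)⟩
      · exact Or.inl ⟨a, ha, b, hb, key a (Or.inl ha) b (Or.inr hb)⟩
termination_by (x, y)
decreasing_by
  · exact Prod.Lex.left _ _ ha
  · exact Prod.Lex.right _ hb
  · exact Prod.Lex.left _ _ ha

theorem mem_left_neg {x z : Game.{u}} : z ∈ (-x).left ↔ ∃ r ∈ x.right, -r = z := by
  rw [left_neg]; rfl

theorem mem_right_neg {x z : Game.{u}} : z ∈ (-x).right ↔ ∃ l ∈ x.left, -l = z := by
  rw [right_neg]; rfl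

theorem neg_mul' (x y : Game.{u}) : -x * y = -(x * y) := by
  have hx : ∀ a, IsOption a x → -a * y = -(a * y) := fun a ha => neg_mul' a y
  have hy : ∀ b, IsOption b y → -x * b = -(x * b) := fun b hb => neg_mul' x b
  have hxy : ∀ a, IsOption a x → ∀ b, IsOption b y → -a * b = -(a * b) :=
    fun a ha b hb => neg_mul' a b
  have key : ∀ a, IsOption a x → ∀ b, IsOption b y →
      -a * y + -x * b - -a * b = -(a * y + x * b - a * b) := by
    intro a ha b hb
    rw [hx a ha, hy b hb, hxy a ha b hb, sub_def, sub_def, neg_add', neg_add']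
  ext z
  · rw [mem_left_mul, mem_left_neg]
    simp only [mem_left_neg, mem_right_neg, mem_right_mul]
    constructor
    · rintro (⟨_, ⟨a, ha, rfl⟩, b, hb, rfl⟩ | ⟨_, ⟨a, ha, rfl⟩, b, hb, rfl⟩)
      · exact ⟨_, Or.inr ⟨a, ha, b, hb, rfl⟩, (key a (Or.inr ha) b (Or.inl hb)).symm⟩
      · exact ⟨_, Or.inl ⟨a, ha, b, hb, rfl⟩, (key a (Or.inl ha) b (Or.inr hb)).symm⟩
    · rintro ⟨_, ⟨a, ha, b, hb, rfl⟩ | ⟨a, ha, b, hb, rfl⟩, rfl⟩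
      · exact Or.inr ⟨_, ⟨a, ha, rfl⟩, b, hb, key a (Or.inl ha) b (Or.inr hb)⟩
      · exact Or.inl ⟨_, ⟨a, ha, rfl⟩, b, hb, key a (Or.inr ha) b (Or.inl hb)⟩
  · rw [mem_right_mul, mem_right_neg]
    simp only [mem_left_neg, mem_right_neg, mem_left_mul]
    constructor
    · rintro (⟨_, ⟨a, ha, rfl⟩, b, hb, rfl⟩ | ⟨_, ⟨a, ha, rfl⟩, b, hb, rfl⟩)
      · exact ⟨_, Or.inr ⟨a, ha, b, hb, rfl⟩, (key a (Or.inr ha) b (Or.inr hb)).symm⟩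
      · exact ⟨_, Or.inl ⟨a, ha, b, hb, rfl⟩, (key a (Or.inl ha) b (Or.inl hb)).symm⟩
    · rintro ⟨_, ⟨a, ha, b, hb, rfl⟩ | ⟨a, ha, b, hb, rfl⟩, rfl⟩
      · exact Or.inr ⟨_, ⟨a, ha, rfl⟩, b, hb, key a (Or.inl ha) b (Or.inl hb)⟩
      · exact Or.inl ⟨_, ⟨a, ha, rfl⟩, b, hb, key a (Or.inr ha) b (Or.inr hb)⟩
termination_by (x, y)
decreasing_by
  · exact Prod.Lex.left _ _ ha
  · exact Prod.Lex.right _ hb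
  · exact Prod.Lex.left _ _ ha

theorem neg_mul_neg' (x y : Game.{u}) : -x * -y = x * y := by
  rw [neg_mul', mul_comm', neg_mul', neg_neg', mul_comm']

/-- The only option of `1` is the left option `0`, so an option `a` of `x` contributes `0·x + 1·a -
0·a`, which is literally `a`. The equality is one of games, and no surreality is involved. -/
theorem ofNat_one_mul (x : Game.{u}) : ofNat 1 * x = x := by
  have hx : ∀ a, IsOption a x → ofNat 1 * a = a := fun a ha => ofNat_one_mul a
  have h0 : ∀ y : Game.{u}, 0 * y = 0 := fun y => by rw [mul_comm', mul_zero']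
  have key : ∀ a, IsOption a x → 0 * x + ofNat 1 * a - 0 * a = a := by
    intro a ha
    rw [hx a ha, h0, h0, sub_def, neg_zero', add_zero', add_comm', add_zero']
  have hl : (ofNat 1 : Game.{u}).left = {0} := left_ofSets _ _
  have hr : (ofNat 1 : Game.{u}).right = ∅ := right_ofSets _ _
  ext z
  · rw [mem_left_mul, hl, hr]
    constructor
    · rintro (⟨_, rfl, a, ha, rfl⟩ | ⟨_, h, _⟩)
      · rwa [key a (Or.inl ha)]
      · exact h.elim
    · exact fun h => Or.inl ⟨0, rfl, z, h, key z (Or.inl h)⟩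
  · rw [mem_right_mul, hl, hr]
    constructor
    · rintro (⟨_, rfl, a, ha, rfl⟩ | ⟨_, h, _⟩)
      · rwa [key a (Or.inr ha)]
      · exact h.elim
    · exact fun h => Or.inl ⟨0, rfl, z, h, key z (Or.inr h)⟩
termination_by x
decreasing_by exact ha

theorem val_eq_of_options {x y : Game.{u}} (h₁ : ∀ a ∈ x.left, ∃ b ∈ y.left, a.val = b.val)
    (h₂ : ∀ a ∈ y.left, ∃ b ∈ x.left, a.val = b.val)
    (h₃ : ∀ a ∈ x.right, ∃ b ∈ y.right, a.val = b.val)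
    (h₄ : ∀ a ∈ y.right, ∃ b ∈ x.right, a.val = b.val) : x.val = y.val := by
  apply le_antisymm <;> rw [val_le_val] <;> apply le_of_options <;> intro a ha
  · obtain ⟨b, hb, h⟩ := h₁ a ha; exact ⟨b, hb, val_le_val.1 h.le⟩
  · obtain ⟨b, hb, h⟩ := h₄ a ha; exact ⟨b, hb, val_le_val.1 h.ge⟩
  · obtain ⟨b, hb, h⟩ := h₂ a ha; exact ⟨b, hb, val_le_val.1 h.le⟩
  · obtain ⟨b, hb, h⟩ := h₃ a ha; exact ⟨b, hb, val_le_val.1 h.ge⟩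

theorem mem_left_add {x y z : Game.{u}} :
    z ∈ (x + y).left ↔ (∃ l ∈ x.left, l + y = z) ∨ ∃ l ∈ y.left, x + l = z := by
  rw [left_add]; rfl

theorem mem_right_add {x y z : Game.{u}} :
    z ∈ (x + y).right ↔ (∃ l ∈ x.right, l + y = z) ∨ ∃ l ∈ y.right, x + l = z := by
  rw [right_add]; rfl

/-- The options of the two sides correspond one to one: those built from an option of `y` by `key1`,
those from an option of `z` by `key2`. Corresponding options are equal only as values, because
subtracted terms have to cancel. -/
theorem val_mul_add (x y z : Game.{u}) : (x * (y + z)).val = (x * y).val + (x * z).val := by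
  have hx : ∀ a, IsOption a x → (a * (y + z)).val = (a * y).val + (a * z).val :=
    fun a ha => val_mul_add a y z
  have hy : ∀ b, IsOption b y → (x * (b + z)).val = (x * b).val + (x * z).val :=
    fun b hb => val_mul_add x b z
  have hz : ∀ b, IsOption b z → (x * (y + b)).val = (x * y).val + (x * b).val :=
    fun b hb => val_mul_add x y b
  have hxy : ∀ a, IsOption a x → ∀ b, IsOption b y →
      (a * (b + z)).val = (a * b).val + (a * z).val :=
    fun a ha b hb => val_mul_add a b z
  have hxz : ∀ a, IsOption a x → ∀ b, IsOption b z →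
      (a * (y + b)).val = (a * y).val + (a * b).val :=
    fun a ha b hb => val_mul_add a y b
  have key1 : ∀ a, IsOption a x → ∀ b, IsOption b y →
      (a * (y + z) + x * (b + z) - a * (b + z)).val = (a * y + x * b - a * b + x * z).val := by
    intro a ha b hb
    simp only [val_add, val_sub, hx a ha, hy b hb, hxy a ha b hb]
    abel
  have key2 : ∀ a, IsOption a x → ∀ b, IsOption b z →
      (a * (y + z) + x * (y + b) - a * (y + b)).val = (x * y + (a * z + x * b - a * b)).val := by
    intro a ha b hb
    simp only [val_add, val_sub, hx a ha, hz b hb, hxz a ha b hb]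
    abel
  rw [← val_add]
  apply val_eq_of_options <;>
    simp only [mem_left_mul, mem_right_mul, mem_left_add, mem_right_add]
  · rintro _ (⟨a, ha, _, ⟨b, hb, rfl⟩ | ⟨b, hb, rfl⟩, rfl⟩ |
      ⟨a, ha, _, ⟨b, hb, rfl⟩ | ⟨b, hb, rfl⟩, rfl⟩)
    · exact ⟨_, Or.inl ⟨_, Or.inl ⟨a, ha, b, hb, rfl⟩, rfl⟩, key1 a (Or.inl ha) b (Or.inl hb)⟩
    · exact ⟨_, Or.inr ⟨_, Or.inl ⟨a, ha, b, hb, rfl⟩, rfl⟩, key2 a (Or.inl ha) b (Or.inl hb)⟩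
    · exact ⟨_, Or.inl ⟨_, Or.inr ⟨a, ha, b, hb, rfl⟩, rfl⟩, key1 a (Or.inr ha) b (Or.inr hb)⟩
    · exact ⟨_, Or.inr ⟨_, Or.inr ⟨a, ha, b, hb, rfl⟩, rfl⟩, key2 a (Or.inr ha) b (Or.inr hb)⟩
  · rintro _ (⟨_, ⟨a, ha, b, hb, rfl⟩ | ⟨a, ha, b, hb, rfl⟩, rfl⟩ |
      ⟨_, ⟨a, ha, b, hb, rfl⟩ | ⟨a, ha, b, hb, rfl⟩, rfl⟩)
    · exact ⟨_, Or.inl ⟨a, ha, _, Or.inl ⟨b, hb, rfl⟩, rfl⟩,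
        (key1 a (Or.inl ha) b (Or.inl hb)).symm⟩
    · exact ⟨_, Or.inr ⟨a, ha, _, Or.inl ⟨b, hb, rfl⟩, rfl⟩,
        (key1 a (Or.inr ha) b (Or.inr hb)).symm⟩
    · exact ⟨_, Or.inl ⟨a, ha, _, Or.inr ⟨b, hb, rfl⟩, rfl⟩,
        (key2 a (Or.inl ha) b (Or.inl hb)).symm⟩
    · exact ⟨_, Or.inr ⟨a, ha, _, Or.inr ⟨b, hb, rfl⟩, rfl⟩,
        (key2 a (Or.inr ha) b (Or.inr hb)).symm⟩
  · rintro _ (⟨a, ha, _, ⟨b, hb, rfl⟩ | ⟨b, hb, rfl⟩, rfl⟩ |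
      ⟨a, ha, _, ⟨b, hb, rfl⟩ | ⟨b, hb, rfl⟩, rfl⟩)
    · exact ⟨_, Or.inl ⟨_, Or.inl ⟨a, ha, b, hb, rfl⟩, rfl⟩, key1 a (Or.inl ha) b (Or.inr hb)⟩
    · exact ⟨_, Or.inr ⟨_, Or.inl ⟨a, ha, b, hb, rfl⟩, rfl⟩, key2 a (Or.inl ha) b (Or.inr hb)⟩
    · exact ⟨_, Or.inl ⟨_, Or.inr ⟨a, ha, b, hb, rfl⟩, rfl⟩, key1 a (Or.inr ha) b (Or.inl hb)⟩
    · exact ⟨_, Or.inr ⟨_, Or.inr ⟨a, ha, b, hb, rfl⟩, rfl⟩, key2 a (Or.inr ha) b (Or.inl hb)⟩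
  · rintro _ (⟨_, ⟨a, ha, b, hb, rfl⟩ | ⟨a, ha, b, hb, rfl⟩, rfl⟩ |
      ⟨_, ⟨a, ha, b, hb, rfl⟩ | ⟨a, ha, b, hb, rfl⟩, rfl⟩)
    · exact ⟨_, Or.inl ⟨a, ha, _, Or.inl ⟨b, hb, rfl⟩, rfl⟩,
        (key1 a (Or.inl ha) b (Or.inr hb)).symm⟩
    · exact ⟨_, Or.inr ⟨a, ha, _, Or.inl ⟨b, hb, rfl⟩, rfl⟩,
        (key1 a (Or.inr ha) b (Or.inl hb)).symm⟩
    · exact ⟨_, Or.inl ⟨a, ha, _, Or.inr ⟨b, hb, rfl⟩, rfl⟩,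
        (key2 a (Or.inl ha) b (Or.inr hb)).symm⟩
    · exact ⟨_, Or.inr ⟨a, ha, _, Or.inr ⟨b, hb, rfl⟩, rfl⟩,
        (key2 a (Or.inr ha) b (Or.inl hb)).symm⟩
termination_by (x, y, z)
decreasing_by
  · exact Prod.Lex.left _ _ ha
  · exact Prod.Lex.right _ (Prod.Lex.left _ _ hb)
  · exact Prod.Lex.right _ (Prod.Lex.right _ hb)
  · exact Prod.Lex.left _ _ ha
  · exact Prod.Lex.left _ _ ha

theorem val_add_mul (x y z : Game.{u}) : ((x + y) * z).val = (x * z).val + (y * z).val := by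
  rw [mul_comm', val_mul_add, mul_comm' z, mul_comm' z]

/-! ### Products of surreal numbers -/

instance : IsWellFounded Game.{u} IsOption := ⟨isOption_wf⟩

/-- The rank of a game in the well-founded order generated by `IsOption`. -/
noncomputable def rank (x : Game.{u}) : Ordinal.{u + 1} := IsWellFounded.rank IsOption x

theorem IsOption.rank_lt {x y : Game.{u}} (h : IsOption x y) : x.rank < y.rank :=
  IsWellFounded.rank_lt_of_rel h

theorem rank_neg_le (x : Game.{u}) : (-x).rank ≤ x.rank := by
  have h : ∀ o, IsOption o x → (-o).rank ≤ o.rank := fun o ho => rank_neg_le o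
  rw [rank, IsWellFounded.rank_eq]
  refine Ordinal.iSup_le ?_
  rintro ⟨_, ho⟩
  have ho' := ho
  rw [IsOption, left_neg, right_neg] at ho'
  rw [Order.succ_le_iff]
  rcases ho' with ⟨o, h', rfl⟩ | ⟨o, h', rfl⟩
  · exact (h o (Or.inr h')).trans_lt (IsOption.rank_lt (Or.inr h'))
  · exact (h o (Or.inl h')).trans_lt (IsOption.rank_lt (Or.inl h'))
termination_by x
decreasing_by exact ho

@[simp]
theorem rank_neg (x : Game.{u}) : (-x).rank = x.rank :=
  (rank_neg_le x).antisymm (by simpa only [neg_neg'] using rank_neg_le (-x))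

theorem Value.lt_of_sub_eq {a b c d : Value.{u}} (h : a < b) (e : d - c = b - a) : c < d := by
  rw [← sub_pos, e, sub_pos]
  exact h

theorem Value.lt_of_sub_eq_add {a b c d a' b' : Value.{u}} (h : a < b) (h' : a' < b')
    (e : d - c = (b - a) + (b' - a')) : c < d := by
  rw [← sub_pos, e]
  exact add_pos (sub_pos.2 h) (sub_pos.2 h')

/-- The inequality `(x₂ - x₁) (y₂ - y₁) > 0`, expanded. -/
def MulMono (x₁ x₂ y₁ y₂ : Game.{u}) : Prop :=
  (x₁ * y₂).val + (x₂ * y₁).val < (x₁ * y₁).val + (x₂ * y₂).val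

theorem MulMono.swap {x₁ x₂ y₁ y₂ : Game.{u}} (h : MulMono x₁ x₂ y₁ y₂) :
    MulMono y₁ y₂ x₁ x₂ := by
  unfold MulMono at *
  rw [mul_comm' y₁, mul_comm' y₂, mul_comm' y₁, mul_comm' y₂]
  rwa [add_comm (x₂ * y₁).val]

/-- Multiplication by `y` respects `≈` at `x₁, x₂`, and the options of `y` are on the correct sides
of `y` relative to `x₁ < x₂`. -/
def MulSlice (x₁ x₂ y : Game.{u}) : Prop :=
  (x₁.Equiv x₂ → (x₁ * y).val = (x₂ * y).val) ∧
    (x₁ < x₂ → (∀ l ∈ y.left, MulMono x₁ x₂ l y) ∧ ∀ r ∈ y.right, MulMono x₁ x₂ y r)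

/-! ### Comparisons of multisets of ranks in the Dershowitz–Manna order -/

section Measure

variable {a b x y z : Ordinal.{u + 1}}

theorem dm_replace {X Y : Multiset Ordinal.{u + 1}} (h : ∀ y ∈ Y, y < x) :
    Multiset.IsDershowitzMannaLT (X + Y) (X + {x}) :=
  ⟨X, Y, {x}, by simp, rfl, rfl, fun y hy => ⟨x, by simp, h y hy⟩⟩

theorem dm_pair_left (h : a < x) : Multiset.IsDershowitzMannaLT {a, y} {x, y} := by
  convert dm_replace (X := {y}) (Y := {a}) (x := x) (by simpa) using 1 <;>
  exact Multiset.cons_swap _ _ _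

theorem dm_pair_right (h : b < y) : Multiset.IsDershowitzMannaLT {x, b} {x, y} :=
  dm_replace (X := {x}) (Y := {b}) (by simpa)

theorem dm_pair_both (h : a < x) (h' : b < y) : Multiset.IsDershowitzMannaLT {a, b} {x, y} :=
  (dm_pair_left h).trans (dm_pair_right h')

/-- A slice at two options of `x` and the factor `y` lies below the product `x * y`: one rank is
traded for two smaller ones. A sum of ranks would not guarantee this, hence the multiset order. -/
theorem dm_triple_pair_left (h : a < x) (h' : b < x) :
    Multiset.IsDershowitzMannaLT {a, b, y} {x, y} := by
  convert dm_replace (X := {y}) (Y := {a, b}) (x := x) (by simp [h, h']) using 1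
  · simp only [Multiset.insert_eq_cons, ← Multiset.singleton_add]; abel
  · simp only [Multiset.insert_eq_cons, ← Multiset.singleton_add]; abel

theorem dm_triple_pair_right (h : a < y) (h' : b < y) :
    Multiset.IsDershowitzMannaLT {a, b, x} {x, y} := by
  rw [Multiset.pair_comm x y]
  exact dm_triple_pair_left h h'

theorem dm_pair_triple_left : Multiset.IsDershowitzMannaLT {x, z} {x, y, z} := by
  convert dm_replace (X := {x, z}) (Y := 0) (x := y) (by simp) using 1 <;>
  · simp only [Multiset.insert_eq_cons, ← Multiset.singleton_add]; abel

theorem dm_pair_triple_right : Multiset.IsDershowitzMannaLT {y, z} {x, y, z} := by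
  convert dm_replace (X := {y, z}) (Y := 0) (x := x) (by simp) using 1 <;>
  · simp only [Multiset.insert_eq_cons, ← Multiset.singleton_add]; abel

theorem dm_triple_fst (h : a < x) : Multiset.IsDershowitzMannaLT {a, y, z} {x, y, z} := by
  convert dm_replace (X := {y, z}) (Y := {a}) (x := x) (by simpa) using 1 <;>
  · simp only [Multiset.insert_eq_cons, ← Multiset.singleton_add]; abel

theorem dm_triple_snd (h : a < y) : Multiset.IsDershowitzMannaLT {x, a, z} {x, y, z} := by
  convert dm_replace (X := {x, z}) (Y := {a}) (x := y) (by simpa) using 1 <;>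
  · simp only [Multiset.insert_eq_cons, ← Multiset.singleton_add]; abel

theorem dm_triple_trd (h : a < z) : Multiset.IsDershowitzMannaLT {x, y, a} {x, y, z} := by
  convert dm_replace (X := {x, y}) (Y := {a}) (x := z) (by simpa) using 1 <;>
  · simp only [Multiset.insert_eq_cons, ← Multiset.singleton_add]; abel

end Measure

theorem triple_swap (x y z : Ordinal.{u + 1}) :
    ({x, y, z} : Multiset Ordinal.{u + 1}) = {y, x, z} := Multiset.cons_swap _ _ _

/-- The induction hypothesis on slices below the pair `x, y`. -/
def SlicesBelow (x y : Game.{u}) : Prop :=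
  ∀ a b c : Game.{u}, a.IsSurreal → b.IsSurreal → c.IsSurreal →
    Multiset.IsDershowitzMannaLT {a.rank, b.rank, c.rank} {x.rank, y.rank} → MulSlice a b c

theorem SlicesBelow.swap {x y : Game.{u}} (h : SlicesBelow x y) : SlicesBelow y x := by
  intro a b c ha hb hc hlt
  rw [Multiset.pair_comm y.rank] at hlt
  exact h a b c ha hb hc hlt

theorem SlicesBelow.neg {x y : Game.{u}} (h : SlicesBelow x y) : SlicesBelow (-x) (-y) := by
  intro a b c ha hb hc hlt
  rw [rank_neg, rank_neg] at hlt
  exact h a b c ha hb hc hlt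

/-- The two options differ in both coordinates, so an intermediate expression is inserted. Moving
from `c` to `r` at a fixed `k ∈ {l, l'}` gains `(x - k)(r - c) > 0`; moving from `l` to `l'` gains
`(l' - l)(y - c)` or `(l - l')(r - y)`. -/
theorem SlicesBelow.left_lt_right {x y : Game.{u}} (h : SlicesBelow x y) (hx : x.IsSurreal)
    (hy : y.IsSurreal) {l l' c r : Game.{u}} (hl : l ∈ x.left) (hl' : l' ∈ x.left)
    (hc : c ∈ y.left) (hr : r ∈ y.right) :
    (l * y + x * c - l * c).val < (l' * y + x * r - l' * r).val := by
  have hl1 := IsOption.rank_lt (Or.inl hl)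
  have hl2 := IsOption.rank_lt (Or.inl hl')
  have hc1 := IsOption.rank_lt (Or.inl hc)
  have hr1 := IsOption.rank_lt (Or.inr hr)
  have sl := hx.of_left hl
  have sl' := hx.of_left hl'
  have sc := hy.of_left hc
  have sr := hy.of_right hr
  have hcr : c < r := (hy.left_lt hc).trans (hy.lt_right hr)
  have m1 : ∀ k ∈ x.left, MulMono k x c r := fun k hk =>
    (((h c r x sc sr hx (dm_triple_pair_right hc1 hr1)).2 hcr).1 k hk).swap
  have m2 : l < l' → MulMono l l' c y := fun hll =>
    ((h l l' y sl sl' hy (dm_triple_pair_left hl1 hl2)).2 hll).1 c hc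
  have m3 : l' < l → MulMono l' l y r := fun hll =>
    ((h l' l y sl' sl hy (dm_triple_pair_left hl2 hl1)).2 hll).2 r hr
  have e1 := (h l l' y sl sl' hy (dm_triple_pair_left hl1 hl2)).1
  have e2 := (h l l' c sl sl' sc ((dm_triple_pair_left hl1 hl2).trans (dm_pair_right hc1))).1
  have n1 := m1 l hl
  have n2 := m1 l' hl'
  unfold MulMono at *
  simp only [val_add, val_sub]
  -- The order of `l` and `l'` decides which change comes first, so that the gain from `l` to `l'`
  -- is a positive product.
  by_cases h1 : l ≤ l'
  · by_cases h2 : l' ≤ l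
    · rw [e1 ⟨h1, h2⟩, e2 ⟨h1, h2⟩]
      exact Value.lt_of_sub_eq n2 (by abel)
    · exact Value.lt_of_sub_eq_add (m2 ⟨h1, h2⟩) n2 (by abel)
  · exact Value.lt_of_sub_eq_add (m3 ((sl'.lt_iff_not_le sl).2 h1)) n1 (by abel)

theorem SlicesBelow.isSurreal_mul {x y : Game.{u}} (h : SlicesBelow x y) (hx : x.IsSurreal)
    (hy : y.IsSurreal) (IH : ∀ a b : Game.{u}, a.IsSurreal → b.IsSurreal →
      Multiset.IsDershowitzMannaLT {a.rank, b.rank} {x.rank, y.rank} → (a * b).IsSurreal) :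
    (x * y).IsSurreal := by
  have hopt : ∀ a, IsOption a x → ∀ b, IsOption b y → (a * y + x * b - a * b).IsSurreal := by
    intro a ha b hb
    have sa := hx.of_isOption ha
    have sb := hy.of_isOption hb
    exact ((IH a y sa hy (dm_pair_left ha.rank_lt)).add
      (IH x b hx sb (dm_pair_right hb.rank_lt))).sub
      (IH a b sa sb (dm_pair_both ha.rank_lt hb.rank_lt))
  have swap : ∀ a b : Game.{u}, a * y + x * b - a * b = b * x + y * a - b * a := by
    intro a b
    rw [mul_comm' a y, mul_comm' x b, mul_comm' a b, add_comm']
  have neg : ∀ a b : Game.{u}, a * y + x * b - a * b = -a * -y + -x * -b - -a * -b := by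
    intro a b
    rw [neg_mul_neg', neg_mul_neg', neg_mul_neg']
  have swapneg : ∀ a b : Game.{u}, a * y + x * b - a * b = -b * -x + -y * -a - -b * -a := by
    intro a b
    rw [swap, neg_mul_neg', neg_mul_neg', neg_mul_neg']
  apply isSurreal_of_lt
  · intro z hz
    rcases mem_left_mul.1 hz with ⟨a, ha, b, hb, rfl⟩ | ⟨a, ha, b, hb, rfl⟩
    · exact hopt a (Or.inl ha) b (Or.inl hb)
    · exact hopt a (Or.inr ha) b (Or.inr hb)
  · intro z hz
    rcases mem_right_mul.1 hz with ⟨a, ha, b, hb, rfl⟩ | ⟨a, ha, b, hb, rfl⟩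
    · exact hopt a (Or.inl ha) b (Or.inr hb)
    · exact hopt a (Or.inr ha) b (Or.inl hb)
  · intro z hz w hw
    rw [← val_lt_val]
    rcases mem_left_mul.1 hz with ⟨a, ha, b, hb, rfl⟩ | ⟨a, ha, b, hb, rfl⟩ <;>
    rcases mem_right_mul.1 hw with ⟨c, hc, d, hd, rfl⟩ | ⟨c, hc, d, hd, rfl⟩
    -- The four combinations of a left and a right option of the product reduce to this one by
    -- exchanging the factors, negating both, or doing both; negation preserves rank.
    · exact h.left_lt_right hx hy ha hc hb hd
    · rw [swap, swap]
      exact h.swap.left_lt_right hy hx hb hd ha hc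
    · rw [swapneg, swapneg]
      exact h.neg.swap.left_lt_right hy.neg hx.neg (neg_mem_left_neg hb) (neg_mem_left_neg hd)
        (neg_mem_left_neg ha) (neg_mem_right_neg hc)
    · rw [neg, neg]
      exact h.neg.left_lt_right hx.neg hy.neg (neg_mem_left_neg ha) (neg_mem_left_neg hc)
        (neg_mem_left_neg hb) (neg_mem_right_neg hd)

/-- A surreal product lies strictly between its options; expanded, these inequalities are the four
sign rules for `(x - a)(y - b)`. -/
theorem mul_option_lt {x y : Game.{u}} (h : (x * y).IsSurreal) :
    (∀ a ∈ x.left, ∀ b ∈ y.left, MulMono a x b y) ∧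
    (∀ a ∈ x.left, ∀ b ∈ y.right, MulMono a x y b) ∧
    (∀ a ∈ x.right, ∀ b ∈ y.left, MulMono x a b y) ∧
    (∀ a ∈ x.right, ∀ b ∈ y.right, MulMono x a y b) := by
  unfold MulMono
  refine ⟨fun a ha b hb => ?_, fun a ha b hb => ?_, fun a ha b hb => ?_, fun a ha b hb => ?_⟩
  · have := val_lt_val.2 (h.left_lt (mem_left_mul.2 (Or.inl ⟨a, ha, b, hb, rfl⟩)))
    simp only [val_add, val_sub] at this
    exact Value.lt_of_sub_eq this (by abel)
  · have := val_lt_val.2 (h.lt_right (mem_right_mul.2 (Or.inl ⟨a, ha, b, hb, rfl⟩)))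
    simp only [val_add, val_sub] at this
    exact Value.lt_of_sub_eq this (by abel)
  · have := val_lt_val.2 (h.lt_right (mem_right_mul.2 (Or.inr ⟨a, ha, b, hb, rfl⟩)))
    simp only [val_add, val_sub] at this
    exact Value.lt_of_sub_eq this (by abel)
  · have := val_lt_val.2 (h.left_lt (mem_left_mul.2 (Or.inr ⟨a, ha, b, hb, rfl⟩)))
    simp only [val_add, val_sub] at this
    exact Value.lt_of_sub_eq this (by abel)

theorem MulMono.trans_left {x₁ x₂ x₃ y₁ y₂ : Game.{u}} (h : MulMono x₁ x₂ y₁ y₂)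
    (h' : MulMono x₂ x₃ y₁ y₂) : MulMono x₁ x₃ y₁ y₂ := by
  exact Value.lt_of_sub_eq_add h h' (by abel)

/-- The induction hypothesis on slices below the triple `x₁, x₂, y`. -/
def SlicesBelow₃ (x₁ x₂ y : Game.{u}) : Prop :=
  ∀ a b c : Game.{u}, a.IsSurreal → b.IsSurreal → c.IsSurreal →
    Multiset.IsDershowitzMannaLT {a.rank, b.rank, c.rank} {x₁.rank, x₂.rank, y.rank} →
      MulSlice a b c

theorem SlicesBelow₃.swap {x₁ x₂ y : Game.{u}} (h : SlicesBelow₃ x₁ x₂ y) :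
    SlicesBelow₃ x₂ x₁ y := by
  intro a b c ha hb hc hlt
  rw [triple_swap x₂.rank] at hlt
  exact h a b c ha hb hc hlt

/-- An option of `x₁` lies on the same side of `x₂`, and conversely. Each required inequality
between an option of one product and the other product is thus a slice with one entry replaced by an
option; terms `x₁ * c` and `x₂ * c` are interchangeable by induction. -/
theorem SlicesBelow₃.val_mul_le {x₁ x₂ y : Game.{u}} (h : SlicesBelow₃ x₁ x₂ y)
    (h₁ : x₁.IsSurreal) (h₂ : x₂.IsSurreal) (hy : y.IsSurreal) (s₁ : (x₁ * y).IsSurreal)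
    (s₂ : (x₂ * y).IsSurreal) (he : x₁.Equiv x₂) : (x₁ * y).val ≤ (x₂ * y).val := by
  have eq : ∀ c, IsOption c y → (x₁ * c).val = (x₂ * c).val := fun c hc =>
    (h x₁ x₂ c h₁ h₂ (hy.of_isOption hc) (dm_triple_trd hc.rank_lt)).1 he
  rw [val_le_val, s₁.le_iff_lt s₂]
  constructor
  · intro z hz
    rw [← val_lt_val]
    rcases mem_left_mul.1 hz with ⟨a, ha, c, hc, rfl⟩ | ⟨a, ha, c, hc, rfl⟩
    · have := ((h a x₂ y (h₁.of_left ha) h₂ hy (dm_triple_fst (IsOption.rank_lt (Or.inl ha)))).2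
        ((h₁.left_lt ha).trans_le he.1)).1 c hc
      have e := eq c (Or.inl hc)
      simp only [val_add, val_sub]
      exact Value.lt_of_sub_eq this (by rw [e]; abel)
    · have := ((h x₂ a y h₂ (h₁.of_right ha) hy (triple_swap a.rank x₂.rank y.rank ▸
        dm_triple_fst (IsOption.rank_lt (Or.inr ha)))).2 (he.2.trans_lt (h₁.lt_right ha))).2 c hc
      have e := eq c (Or.inr hc)
      simp only [val_add, val_sub]
      exact Value.lt_of_sub_eq this (by rw [e]; abel)
  · intro z hz
    rw [← val_lt_val]
    rcases mem_right_mul.1 hz with ⟨a, ha, c, hc, rfl⟩ | ⟨a, ha, c, hc, rfl⟩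
    · have := ((h a x₁ y (h₂.of_left ha) h₁ hy (triple_swap x₁.rank a.rank y.rank ▸
        dm_triple_snd (IsOption.rank_lt (Or.inl ha)))).2 ((h₂.left_lt ha).trans_le he.2)).2 c hc
      have e := eq c (Or.inr hc)
      simp only [val_add, val_sub]
      exact Value.lt_of_sub_eq this (by rw [e]; abel)
    · have := ((h x₁ a y h₁ (h₂.of_right ha) hy (dm_triple_snd (IsOption.rank_lt (Or.inr ha)))).2
        (he.1.trans_lt (h₂.lt_right ha))).1 c hc
      have e := eq c (Or.inl hc)
      simp only [val_add, val_sub]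
      exact Value.lt_of_sub_eq this (by rw [e]; abel)

/-- With an option `a` between `x₁` and `x₂`, the product `(x₂ - x₁)(d - c)` splits at `a`. One part
is positive because `a` is an option of an endpoint (`hL`, `hR`), the other by induction, or zero
when `a` is equivalent to the other endpoint. The disjunction `hcd` covers left and right options of
`y` at once. -/
theorem SlicesBelow₃.mulMono {x₁ x₂ y c d : Game.{u}} (h : SlicesBelow₃ x₁ x₂ y)
    (h₁ : x₁.IsSurreal) (h₂ : x₂.IsSurreal) (hy : y.IsSurreal) (hlt : x₁ < x₂)
    (hcd : IsOption c y ∧ d = y ∨ c = y ∧ IsOption d y)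
    (hS : ∀ a b, MulSlice a b y → a < b → MulMono a b c d)
    (hL : ∀ a ∈ x₂.left, MulMono a x₂ c d) (hR : ∀ a ∈ x₁.right, MulMono x₁ a c d) :
    MulMono x₁ x₂ c d := by
  have heq : ∀ a b e, MulSlice a b y → (∀ f, IsOption f y → MulSlice a b f) → a.Equiv b →
      (e = y ∨ IsOption e y) → (a * e).val = (b * e).val := by
    rintro a b e hs hf hab (rfl | he)
    exacts [hs.1 hab, (hf e he).1 hab]
  have hc : c = y ∨ IsOption c y := hcd.elim (fun h => Or.inr h.1) fun h => Or.inl h.1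
  have hd : d = y ∨ IsOption d y := hcd.elim (fun h => Or.inl h.2) fun h => Or.inr h.2
  rcases not_le_iff.1 hlt.2 with ⟨a, ha, hle⟩ | ⟨a, ha, hle⟩
  · have sa := h₂.of_left ha
    have hr := IsOption.rank_lt (Or.inl ha)
    have hs := h x₁ a y h₁ sa hy (dm_triple_snd hr)
    have hA := hL a ha
    by_cases hle' : a ≤ x₁
    · have hf : ∀ f, IsOption f y → MulSlice x₁ a f := fun f hf =>
        h x₁ a f h₁ sa (hy.of_isOption hf) ((dm_triple_snd hr).trans (dm_triple_trd hf.rank_lt))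
      unfold MulMono at hA ⊢
      rwa [heq x₁ a c hs hf ⟨hle, hle'⟩ hc, heq x₁ a d hs hf ⟨hle, hle'⟩ hd]
    · exact (hS x₁ a hs ⟨hle, hle'⟩).trans_left hA
  · have sa := h₁.of_right ha
    have hr := IsOption.rank_lt (Or.inr ha)
    have hs := h a x₂ y sa h₂ hy (dm_triple_fst hr)
    have hA := hR a ha
    by_cases hle' : x₂ ≤ a
    · have hf : ∀ f, IsOption f y → MulSlice a x₂ f := fun f hf =>
        h a x₂ f sa h₂ (hy.of_isOption hf) ((dm_triple_fst hr).trans (dm_triple_trd hf.rank_lt))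
      unfold MulMono at hA ⊢
      rwa [← heq a x₂ c hs hf ⟨hle, hle'⟩ hc, ← heq a x₂ d hs hf ⟨hle, hle'⟩ hd]
    · exact hA.trans_left (hS a x₂ hs ⟨hle, hle'⟩)

theorem SlicesBelow₃.mulSlice {x₁ x₂ y : Game.{u}} (h : SlicesBelow₃ x₁ x₂ y)
    (h₁ : x₁.IsSurreal) (h₂ : x₂.IsSurreal) (hy : y.IsSurreal) (s₁ : (x₁ * y).IsSurreal)
    (s₂ : (x₂ * y).IsSurreal) : MulSlice x₁ x₂ y := by
  obtain ⟨-, -, a₃, a₄⟩ := mul_option_lt s₁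
  obtain ⟨b₁, b₂, -, -⟩ := mul_option_lt s₂
  refine ⟨fun he => (h.val_mul_le h₁ h₂ hy s₁ s₂ he).antisymm
    (h.swap.val_mul_le h₂ h₁ hy s₂ s₁ he.symm), fun hlt => ⟨fun l hl => ?_, fun r hr => ?_⟩⟩
  · exact h.mulMono h₁ h₂ hy hlt (Or.inl ⟨Or.inl hl, rfl⟩) (fun a b hs hab => (hs.2 hab).1 l hl)
      (fun a ha => b₁ a ha l hl) fun a ha => a₃ a ha l hl
  · exact h.mulMono h₁ h₂ hy hlt (Or.inr ⟨rfl, Or.inr hr⟩) (fun a b hs hab => (hs.2 hab).2 r hr)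
      (fun a ha => b₂ a ha r hr) fun a ha => a₄ a ha r hr

/-- Surreality of `x * y` needs slices whose ranks lie below the pair of ranks. A slice at `x₁, x₂,
y` needs the products `x₁ * y` and `x₂ * y`, whose pairs arise from the triple by dropping an entry.
One induction over multisets accommodates both. -/
theorem mul_induction (m : Multiset Ordinal.{u + 1}) :
    (∀ x y : Game.{u}, x.IsSurreal → y.IsSurreal → {x.rank, y.rank} = m → (x * y).IsSurreal) ∧
    ∀ x₁ x₂ y : Game.{u}, x₁.IsSurreal → x₂.IsSurreal → y.IsSurreal →
      {x₁.rank, x₂.rank, y.rank} = m → MulSlice x₁ x₂ y := by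
  induction m using (Multiset.wellFounded_isDershowitzMannaLT (α := Ordinal.{u + 1})).induction with
  | _ m ih =>
    constructor
    · rintro x y hx hy rfl
      exact SlicesBelow.isSurreal_mul (fun a b c ha hb hc hlt => (ih _ hlt).2 a b c ha hb hc rfl)
        hx hy fun a b ha hb hlt => (ih _ hlt).1 a b ha hb rfl
    · rintro x₁ x₂ y h₁ h₂ hy rfl
      exact SlicesBelow₃.mulSlice
        (fun a b c ha hb hc hlt => (ih _ hlt).2 a b c ha hb hc rfl) h₁ h₂ hy
        ((ih _ dm_pair_triple_left).1 x₁ y h₁ hy rfl)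
        ((ih _ dm_pair_triple_right).1 x₂ y h₂ hy rfl)

theorem IsSurreal.mul {x y : Game.{u}} (hx : x.IsSurreal) (hy : y.IsSurreal) :
    (x * y).IsSurreal :=
  (mul_induction _).1 x y hx hy rfl

theorem IsSurreal.mulSlice {x₁ x₂ y : Game.{u}} (h₁ : x₁.IsSurreal) (h₂ : x₂.IsSurreal)
    (hy : y.IsSurreal) : MulSlice x₁ x₂ y :=
  (mul_induction _).2 x₁ x₂ y h₁ h₂ hy rfl

theorem val_mul_congr_left {x₁ x₂ y : Game.{u}} (h₁ : x₁.IsSurreal) (h₂ : x₂.IsSurreal)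
    (hy : y.IsSurreal) (h : x₁.val = x₂.val) : (x₁ * y).val = (x₂ * y).val :=
  (h₁.mulSlice h₂ hy).1 (val_eq_val.1 h)

theorem val_mul_congr {x₁ x₂ y₁ y₂ : Game.{u}} (h₁ : x₁.IsSurreal) (h₂ : x₂.IsSurreal)
    (h₁' : y₁.IsSurreal) (h₂' : y₂.IsSurreal) (h : x₁.val = x₂.val) (h' : y₁.val = y₂.val) :
    (x₁ * y₁).val = (x₂ * y₂).val := by
  rw [val_mul_congr_left h₁ h₂ h₁' h, mul_comm' x₂, mul_comm' x₂,
    val_mul_congr_left h₁' h₂' h₂ h']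

/-- Slices give the case in which one of `y₁, y₂` is an option of the other. In general an option
interpolated between `y₁` and `y₂` splits the difference, and the remaining piece is handled by
recursion. -/
theorem IsSurreal.mulMono {x₁ x₂ : Game.{u}} (h₁ : x₁.IsSurreal) (h₂ : x₂.IsSurreal)
    (hx : x₁ < x₂) (y₁ y₂ : Game.{u}) (h₁' : y₁.IsSurreal) (h₂' : y₂.IsSurreal) (hy : y₁ < y₂) :
    MulMono x₁ x₂ y₁ y₂ := by
  rcases not_le_iff.1 hy.2 with ⟨l, hl, hle⟩ | ⟨r, hr, hle⟩
  · have sl := h₂'.of_left hl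
    have m := ((h₁.mulSlice h₂ h₂').2 hx).1 l hl
    by_cases hle' : l ≤ y₁
    · have e := val_eq_val.2 ⟨hle, hle'⟩
      unfold MulMono at m ⊢
      rwa [val_mul_congr h₂ h₂ h₁' sl rfl e, val_mul_congr h₁ h₁ h₁' sl rfl e]
    · exact ((h₁.mulMono h₂ hx y₁ l h₁' sl ⟨hle, hle'⟩).swap.trans_left m.swap).swap
  · have sr := h₁'.of_right hr
    have m := ((h₁.mulSlice h₂ h₁').2 hx).2 r hr
    by_cases hle' : y₂ ≤ r
    · have e := val_eq_val.2 ⟨hle, hle'⟩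
      unfold MulMono at m ⊢
      rwa [← val_mul_congr h₂ h₂ sr h₂' rfl e, ← val_mul_congr h₁ h₁ sr h₂' rfl e]
    · exact (m.swap.trans_left (h₁.mulMono h₂ hx r y₂ sr h₂' ⟨hle, hle'⟩).swap).swap
termination_by (y₁, y₂)
decreasing_by
  · exact Prod.Lex.right _ (isOption_of_left hl)
  · exact Prod.Lex.left _ _ (isOption_of_right hr)

theorem zero_mul' (x : Game.{u}) : 0 * x = 0 := by rw [mul_comm', mul_zero']

theorem val_mul_lt_mul_right {x₁ x₂ y : Game.{u}} (h₁ : x₁.IsSurreal) (h₂ : x₂.IsSurreal)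
    (hy : y.IsSurreal) (hx : x₁ < x₂) (h : 0 < y) : (x₁ * y).val < (x₂ * y).val := by
  have := h₁.mulMono h₂ hx 0 y isSurreal_zero hy h
  simpa [MulMono, mul_zero'] using this

end Game

/-! ### Leading coefficients in linearly ordered groups -/

section LeadingCoefficient

variable {S : Type*} [AddCommGroup S] [LinearOrder S] [IsOrderedAddMonoid S]

theorem AddMonoidHom.map_abs_of_strictMono (f : ℝ →+ S) (hf : StrictMono f) (r : ℝ) :
    |f r| = f |r| := by
  rcases le_total 0 r with h | h
  · rw [abs_of_nonneg h, abs_of_nonneg]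
    simpa using hf.monotone h
  · rw [abs_of_nonpos h, abs_of_nonpos, map_neg]
    simpa using hf.monotone h

/-- The coefficient is the Dedekind cut of `x` in the image of `f`. The bound `hn` makes the cut
bounded above, `hm` makes its supremum positive, and `x` lies between `f (r - ε)` and `f (r + ε)`
for every real `ε > 0`. -/
theorem exists_leading_coeff (f : ℝ →+ S) (hf : StrictMono f) {x : S}
    (hn : ∃ n : ℕ, x < n • f 1) (hm : ∃ m : ℕ, f 1 < m • x) (hx : 0 < x) :
    ∃ r : ℝ, 0 < r ∧ ∀ k : ℕ, k ≠ 0 → k • |x - f r| < f 1 := by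
  obtain ⟨n, hn⟩ := hn
  obtain ⟨m, hm⟩ := hm
  have hf1 : 0 < f 1 := by simpa using hf zero_lt_one
  have hne : {r : ℝ | f r ≤ x}.Nonempty := ⟨0, by simpa using hx.le⟩
  have hbdd : BddAbove {r : ℝ | f r ≤ x} := by
    refine ⟨n, fun r hr => hf.le_iff_le.1 ?_⟩
    have h : f n = n • f 1 := by rw [← map_nsmul, nsmul_one]
    rw [h]
    exact (hr.trans_lt hn).le
  have hlow : ∀ ε > 0, f (sSup {r : ℝ | f r ≤ x} - ε) ≤ x := by
    intro ε hε
    obtain ⟨a, ha, h⟩ := exists_lt_of_lt_csSup hne (sub_lt_self _ hε)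
    exact (hf h).le.trans ha
  have hhigh : ∀ ε > 0, x ≤ f (sSup {r : ℝ | f r ≤ x} + ε) := by
    intro ε hε
    by_contra h
    exact (lt_add_of_pos_right _ hε).not_ge (le_csSup hbdd (le_of_not_ge h))
  refine ⟨sSup {r : ℝ | f r ≤ x}, ?_, fun k hk => ?_⟩
  · have hm0 : m ≠ 0 := by
      rintro rfl
      rw [zero_nsmul] at hm
      exact hm.not_gt hf1
    have hm0' : (m : ℝ) ≠ 0 := Nat.cast_ne_zero.2 hm0
    have h : f (1 / m) ≤ x := by
      refine (lt_of_nsmul_lt_nsmul_right m ?_).le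
      rwa [← map_nsmul, nsmul_eq_mul, mul_one_div_cancel hm0']
    exact lt_of_lt_of_le (by positivity) (le_csSup hbdd h)
  · have hk0 : (k : ℝ) ≠ 0 := Nat.cast_ne_zero.2 hk
    -- The factor `2` provides strictness: `k` copies of `f (1 / (2 * k))` make `f (1 / 2) < f 1`.
    have hε : (0 : ℝ) < 1 / (2 * k) := by positivity
    have h : |x - f (sSup {r : ℝ | f r ≤ x})| ≤ f (1 / (2 * k)) := by
      have h1 := hlow _ hε
      have h2 := hhigh _ hε
      rw [map_sub] at h1
      rw [map_add] at h2
      rw [abs_le]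
      constructor
      · rw [neg_le_sub_iff_le_add, add_comm]
        exact sub_le_iff_le_add'.1 h1
      · exact sub_le_iff_le_add'.2 h2
    refine (nsmul_le_nsmul_right h k).trans_lt ?_
    rw [← map_nsmul, nsmul_eq_mul]
    apply hf
    field_simp
    norm_num

theorem commensurate_of_leading_coeff (f : ℝ →+ S) (hf : StrictMono f) {x : S} {r : ℝ}
    (hr : r ≠ 0) (h : ∀ k : ℕ, k ≠ 0 → k • |x - f r| < f 1) :
    (∃ n : ℕ, |x| < n • f 1) ∧ ∃ m : ℕ, f 1 < m • |x| := by
  constructor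
  · obtain ⟨n, hn⟩ := exists_nat_gt (|r| + 1)
    refine ⟨n, ?_⟩
    have h1 : |x| ≤ |x - f r| + |f r| := by simpa using abs_add_le (x - f r) (f r)
    have h2 := h 1 one_ne_zero
    rw [one_nsmul] at h2
    refine (h1.trans_lt (add_lt_add_left h2 _)).trans ?_
    rw [f.map_abs_of_strictMono hf, ← map_nsmul, ← map_add, nsmul_one, add_comm]
    exact hf hn
  · have hr' : 0 < |r| := abs_pos.2 hr
    -- Now `k * |r| > 2`. One copy of `f 1` absorbs the `k`-fold remainder, and the other is left
    -- below `k • |x|`.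
    obtain ⟨k, hk⟩ := exists_nat_gt (2 / |r|)
    have hk0' : (0 : ℝ) < k := lt_trans (by positivity) hk
    have hk0 : k ≠ 0 := fun h => by simp [h] at hk0'
    refine ⟨k, ?_⟩
    have h1 : |f r| ≤ |x - f r| + |x| := by
      have := abs_add_le (f r - x) x
      rwa [sub_add_cancel, abs_sub_comm] at this
    have h2 := nsmul_le_nsmul_right h1 k
    rw [nsmul_add, f.map_abs_of_strictMono hf, ← map_nsmul] at h2
    have h3 : f 1 + f 1 < f (k • |r|) := by
      rw [← map_add]
      apply hf
      rw [nsmul_eq_mul]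
      rw [div_lt_iff₀ hr'] at hk
      linarith
    have h4 := h3.trans_le (h2.trans (add_le_add_left (h k hk0).le _))
    exact lt_of_add_lt_add_left h4

end LeadingCoefficient

namespace Game

/-! ### The linearly ordered group of values of surreal numbers -/

/-- The values of surreal numbers. -/
def surrealSubgroup : AddSubgroup Value.{u} where
  carrier := {v | ∃ x : Game.{u}, x.IsSurreal ∧ x.val = v}
  add_mem' := by
    rintro _ _ ⟨x, hx, rfl⟩ ⟨y, hy, rfl⟩
    exact ⟨x + y, hx.add hy, rfl⟩
  zero_mem' := ⟨0, isSurreal_zero, rfl⟩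
  neg_mem' := by
    rintro _ ⟨x, hx, rfl⟩
    exact ⟨-x, hx.neg, rfl⟩

noncomputable instance : LinearOrder surrealSubgroup.{u} :=
  { (inferInstance : PartialOrder surrealSubgroup.{u}) with
    le_total := by
      rintro ⟨_, x, hx, rfl⟩ ⟨_, y, hy, rfl⟩
      change x.val ≤ y.val ∨ y.val ≤ x.val
      rw [val_le_val, val_le_val]
      by_cases h : y ≤ x
      · exact Or.inr h
      · exact Or.inl (hx.le_of_not_le hy h)
    toDecidableLE := Classical.decRel _ }

instance : IsOrderedAddMonoid surrealSubgroup.{u} where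
  add_le_add_left _ _ h c := add_le_add_left (α := Value.{u}) h c.1

/-- The value of a surreal number. -/
def IsSurreal.toVal {x : Game.{u}} (hx : x.IsSurreal) : surrealSubgroup.{u} := ⟨x.val, x, hx, rfl⟩

theorem lt_of_nsmul_val_lt {x y : Game.{u}} (hx : x.IsSurreal) (hy : y.IsSurreal) (n : ℕ)
    (h : n • x.val < n • y.val) : x.val < y.val :=
  lt_of_nsmul_lt_nsmul_right (a := hx.toVal) (b := hy.toVal) n h

/-- General games have torsion, for instance `{0 | 0}`; the cancellation rests on the linear order
of the surreal values. -/
theorem eq_of_nsmul_val_eq {x y : Game.{u}} (hx : x.IsSurreal) (hy : y.IsSurreal) {n : ℕ}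
    (hn : n ≠ 0) (h : n • x.val = n • y.val) : x.val = y.val :=
  congrArg Subtype.val (nsmul_right_injective hn
    (show n • hx.toVal = n • hy.toVal from Subtype.ext h))

theorem IsSurreal.val_le_iff {x y : Game.{u}} (hx : x.IsSurreal) (hy : y.IsSurreal) :
    x.val ≤ y.val ↔ (∀ l ∈ x.left, l.val < y.val) ∧ ∀ r ∈ y.right, x.val < r.val := by
  simp only [val_le_val, val_lt_val, hx.le_iff_lt hy]

theorem IsSurreal.absVal {x : Game.{u}} (hx : x.IsSurreal) : x.absVal.IsSurreal := by
  unfold Game.absVal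
  split_ifs
  exacts [hx, hx.neg]

theorem IsSurreal.toVal_absVal {x : Game.{u}} (hx : x.IsSurreal) :
    hx.absVal.toVal = |hx.toVal| := by
  by_cases h : 0 ≤ x
  · have h' : 0 ≤ hx.toVal := val_le_val.2 h
    rw [abs_of_nonneg h']
    exact Subtype.ext (by simp [toVal, Game.absVal, h])
  · have h' : hx.toVal ≤ 0 := val_le_val.2 (hx.le_of_not_le isSurreal_zero h)
    rw [abs_of_nonpos h']
    exact Subtype.ext (by simp [toVal, Game.absVal, h])

/-! ### Canonical representatives -/

theorem mem_uniqOp {β : Ordinal.{u}} {x : Game.{u}} : x ∈ uniqOp β ↔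
    (x ∈ ⋃ γ : Set.Iio β, uniqOp γ.1) ∨
      (x.IsSurreal ∧ β = x.bornEq ∧
        (x.bornEqSet ∩ madeOf (⋃ γ : Set.Iio β, uniqOp γ.1)).Nonempty ∧
        x = theSmallest (x.bornEqSet ∩ madeOf (⋃ γ : Set.Iio β, uniqOp γ.1))) := by
  conv_lhs => rw [uniqOp]
  rfl

theorem bornEqSet_congr {x y : Game.{u}} (h : x.Equiv y) : x.bornEq = y.bornEq := by
  have key : ∀ z : Game.{u}, z.Equiv x ↔ z.Equiv y := fun z =>
    ⟨fun hz => hz.trans h, fun hz => hz.trans h.symm⟩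
  simp only [bornEq, key]

theorem bornEqSet_eq {x y : Game.{u}} (h : x.Equiv y) : x.bornEqSet = y.bornEqSet := by
  have key : ∀ z : Game.{u}, z.Equiv x ↔ z.Equiv y := fun z =>
    ⟨fun hz => hz.trans h, fun hz => hz.trans h.symm⟩
  simp only [bornEqSet, key, bornEqSet_congr h]

theorem IsSurreal.mem_day_born {x : Game.{u}} (hx : x.IsSurreal) : x ∈ Day x.born :=
  csInf_mem (s := {α | x ∈ Day α}) hx

theorem born_le {x : Game.{u}} {α : Ordinal.{u}} (h : x ∈ Day α) : x.born ≤ α := csInf_le' h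

theorem bornEq_le {x y : Game.{u}} (hy : y.IsSurreal) (h : y.Equiv x) : x.bornEq ≤ y.born :=
  csInf_le' ⟨y, hy, h, rfl⟩

theorem IsSurreal.exists_mem_bornEqSet {x : Game.{u}} (hx : x.IsSurreal) :
    x.bornEqSet.Nonempty := by
  obtain ⟨y, h⟩ := csInf_mem
    (s := {α | ∃ y : Game.{u}, y.IsSurreal ∧ y.Equiv x ∧ y.born = α})
    ⟨x.born, x, hx, Equiv.refl x, rfl⟩
  exact ⟨y, h⟩

theorem theSmallest_mem {Y : Set Game.{u}} (hY : Y.Nonempty) : theSmallest Y ∈ Y := by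
  have h : ∃ y, IsSmallest Y y := by
    obtain ⟨y, hy, hmin⟩ := (InvImage.wf cardSum (wellFounded_lt (α := Ordinal.{u + 1}))).has_min
      Y hY
    exact ⟨y, hy, fun z hz => not_lt.1 (hmin z hz)⟩
  exact (Classical.epsilon_spec_aux ⟨0⟩ (IsSmallest Y) h).1

theorem mem_day_of_mem_uniqOp {β : Ordinal.{u}} {x : Game.{u}} (h : x ∈ uniqOp β) :
    x ∈ Day β := by
  rcases mem_uniqOp.1 h with h | ⟨hx, rfl, hne, he⟩
  · obtain ⟨⟨γ, hγ⟩, h⟩ := Set.mem_iUnion.1 h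
    exact day_mono (le_of_lt hγ) (mem_day_of_mem_uniqOp h)
  · have := theSmallest_mem hne
    rw [← he] at this
    obtain ⟨-, -, h⟩ := this.1
    rw [← h]
    exact hx.mem_day_born
termination_by β

/-- A youngest member `y` of the class has options whose classes have earlier birthdays, hence
canonical representatives. Replacing each option by its representative yields an equivalent `z` born
no later, so there is a candidate for the choice on day `β`. -/
theorem exists_equiv_mem_uniqOp (β : Ordinal.{u}) :
    ∀ x : Game.{u}, x.IsSurreal → x.bornEq = β → ∃ y, y.Equiv x ∧ y ∈ uniqOp β := by
  induction β using WellFoundedLT.induction with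
  | _ β ih =>
    rintro x hx rfl
    obtain ⟨y, hy, hyx, hborn⟩ := hx.exists_mem_bornEqSet
    have hday := hy.mem_day_born
    rw [hborn, mem_day_iff] at hday
    have hopt : ∀ o, IsOption o y → ∃ c, c.Equiv o ∧ ∃ γ < x.bornEq, c ∈ uniqOp γ := by
      intro o ho
      obtain ⟨γ, hγ, hoγ⟩ : ∃ γ < x.bornEq, o ∈ Day γ := ho.elim (hday.1 o) (hday.2.1 o)
      have hlt : o.bornEq < x.bornEq :=
        ((bornEq_le ⟨γ, hoγ⟩ (Equiv.refl o)).trans (born_le hoγ)).trans_lt hγ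
      obtain ⟨c, hc, h⟩ := ih _ hlt o ⟨γ, hoγ⟩ rfl
      exact ⟨c, hc, _, hlt, h⟩
    choose! f hf g hg hfg using hopt
    let z : Game.{u} := ofSets (f '' y.left) (f '' y.right)
    have hzl : z.left = f '' y.left := left_ofSets _ _
    have hzr : z.right = f '' y.right := right_ofSets _ _
    have hzy : z.Equiv y := by
      constructor <;> apply le_of_options
      · rw [hzl]
        rintro _ ⟨l, hl, rfl⟩
        exact ⟨l, hl, (hf l (Or.inl hl)).1⟩
      · rw [hzr]
        exact fun r hr => ⟨f r, ⟨r, hr, rfl⟩, (hf r (Or.inr hr)).1⟩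
      · rw [hzl]
        exact fun l hl => ⟨f l, ⟨l, hl, rfl⟩, (hf l (Or.inl hl)).2⟩
      · rw [hzr]
        rintro _ ⟨r, hr, rfl⟩
        exact ⟨r, hr, (hf r (Or.inr hr)).2⟩
    have hzday : z ∈ Day x.bornEq := by
      rw [mem_day_iff, hzl, hzr]
      refine ⟨?_, ?_, ?_⟩
      · rintro _ ⟨l, hl, rfl⟩
        exact ⟨_, hg l (Or.inl hl), mem_day_of_mem_uniqOp (hfg l (Or.inl hl))⟩
      · rintro _ ⟨r, hr, rfl⟩
        exact ⟨_, hg r (Or.inr hr), mem_day_of_mem_uniqOp (hfg r (Or.inr hr))⟩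
      · rintro _ ⟨l, hl, rfl⟩ _ ⟨r, hr, rfl⟩ h
        exact hday.2.2 l hl r hr
          ((hf r (Or.inr hr)).2.trans (h.trans (hf l (Or.inl hl)).1))
    have hz : z.IsSurreal := ⟨_, hzday⟩
    have hzx := hzy.trans hyx
    have hne : (x.bornEqSet ∩ madeOf (⋃ γ : Set.Iio x.bornEq, uniqOp γ.1)).Nonempty := by
      refine ⟨z, ⟨hz, hzx, (born_le hzday).antisymm (bornEq_le hz hzx)⟩, hz, ?_⟩
      rw [hzl, hzr]
      rintro _ (⟨o, ho, rfl⟩ | ⟨o, ho, rfl⟩)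
      · exact Set.mem_iUnion.2 ⟨⟨_, hg o (Or.inl ho)⟩, hfg o (Or.inl ho)⟩
      · exact Set.mem_iUnion.2 ⟨⟨_, hg o (Or.inr ho)⟩, hfg o (Or.inr ho)⟩
    have hmem := theSmallest_mem hne
    refine ⟨_, hmem.1.2.1, mem_uniqOp.2 (Or.inr ⟨hmem.1.1, ?_, ?_, ?_⟩)⟩
    · exact (bornEqSet_congr hmem.1.2.1).symm
    · rwa [bornEqSet_eq hmem.1.2.1]
    · rw [bornEqSet_eq hmem.1.2.1]

theorem IsSurreal.uniq_spec {x : Game.{u}} (hx : x.IsSurreal) :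
    x.uniq.Equiv x ∧ x.uniq ∈ uniqOp x.bornEq :=
  Classical.epsilon_spec_aux ⟨0⟩ (fun y : Game.{u} => y.Equiv x ∧ y ∈ uniqOp x.bornEq)
    (exists_equiv_mem_uniqOp _ x hx rfl)

theorem IsSurreal.uniq_equiv {x : Game.{u}} (hx : x.IsSurreal) : x.uniq.Equiv x := hx.uniq_spec.1

theorem IsSurreal.uniq {x : Game.{u}} (hx : x.IsSurreal) : x.uniq.IsSurreal :=
  ⟨_, mem_day_of_mem_uniqOp hx.uniq_spec.2⟩

/-- The predicate fed to the choice operator depends only on the class, so the two choices coincide.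
This is what makes canonical representatives unique. -/
theorem uniq_congr {x y : Game.{u}} (h : x.Equiv y) : x.uniq = y.uniq := by
  have key : ∀ z : Game.{u}, z.Equiv x ↔ z.Equiv y := fun z =>
    ⟨fun hz => hz.trans h, fun hz => hz.trans h.symm⟩
  unfold Game.uniq
  simp only [key, bornEqSet_congr h]

theorem IsUSurreal.isSurreal {y : Game.{u}} (hy : y.IsUSurreal) : y.IsSurreal := by
  obtain ⟨x, hx, rfl⟩ := hy
  exact hx.uniq

theorem IsUSurreal.eq_of_equiv {y z : Game.{u}} (hy : y.IsUSurreal) (hz : z.IsUSurreal)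
    (h : y.Equiv z) : y = z := by
  obtain ⟨x, hx, rfl⟩ := hy
  obtain ⟨x', hx', rfl⟩ := hz
  exact uniq_congr (hx.uniq_equiv.symm.trans (h.trans hx'.uniq_equiv))

/-! ### Integers and dyadic numbers -/

theorem left_ofNat_succ (n : ℕ) : (ofNat (n + 1) : Game.{u}).left = {ofNat n} := left_ofSets _ _

theorem right_ofNat (n : ℕ) : (ofNat n : Game.{u}).right = ∅ := by
  cases n with
  | zero => exact right_zero
  | succ n => exact right_ofSets _ _

theorem isSurreal_ofNat (n : ℕ) : (ofNat n : Game.{u}).IsSurreal := by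
  induction n with
  | zero => exact isSurreal_zero
  | succ n ih =>
    apply isSurreal_of_lt
    · rw [left_ofNat_succ]; rintro _ rfl; exact ih
    · simp [right_ofNat]
    · simp [right_ofNat]

theorem val_ofNat_succ (n : ℕ) :
    (ofNat (n + 1) : Game.{u}).val = (ofNat n : Game.{u}).val + (ofNat 1 : Game.{u}).val := by
  induction n with
  | zero =>
    exact (zero_add _).symm
  | succ n ih =>
    rw [← val_add]
    apply val_eq_of_options
    · simp only [left_ofNat_succ, mem_left_add, Set.mem_singleton_iff]
      rintro _ rfl
      exact ⟨ofNat (n + 1) + 0, Or.inr ⟨0, rfl, rfl⟩, by simp⟩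
    · simp only [left_ofNat_succ, mem_left_add, Set.mem_singleton_iff]
      rintro _ (⟨_, rfl, rfl⟩ | ⟨l, hl, rfl⟩)
      · exact ⟨_, rfl, ih.symm⟩
      · obtain rfl : l = 0 := hl
        exact ⟨_, rfl, by simp⟩
    · simp [right_ofNat]
    · simp [mem_right_add, right_ofNat]

theorem val_ofNat (n : ℕ) : (ofNat n : Game.{u}).val = n • (ofNat 1 : Game.{u}).val := by
  induction n with
  | zero => rw [zero_nsmul]; rfl
  | succ n ih => rw [val_ofNat_succ, ih, succ_nsmul]

theorem ofNegNat_eq (n : ℕ) : (ofNegNat n : Game.{u}) = -ofNat n := by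
  induction n with
  | zero => exact neg_zero'.symm
  | succ n ih =>
    ext1
    · rw [left_neg, right_ofNat, Set.image_empty]
      exact left_ofSets _ _
    · rw [right_neg, left_ofNat_succ, Set.image_singleton, ← ih]
      exact right_ofSets _ _

theorem isSurreal_ofInt (m : ℤ) : (ofInt m : Game.{u}).IsSurreal := by
  rcases m with n | n
  · exact isSurreal_ofNat n
  · change (ofNegNat (n + 1)).IsSurreal
    rw [ofNegNat_eq]
    exact (isSurreal_ofNat _).neg

theorem val_ofInt (m : ℤ) : (ofInt m : Game.{u}).val = m • (ofNat 1 : Game.{u}).val := by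
  rcases m with n | n
  · exact (val_ofNat n).trans (natCast_zsmul _ _).symm
  · change (ofNegNat (n + 1)).val = _
    rw [ofNegNat_eq, val_neg, val_ofNat, negSucc_zsmul]

theorem left_ofInt {m : ℤ} {l : Game.{u}} (h : l ∈ (ofInt m).left) : l = ofInt (m - 1) := by
  rcases m with (_ | n) | n
  · change l ∈ (0 : Game.{u}).left at h
    simp at h
  · change l ∈ (ofNat (n + 1)).left at h
    rw [left_ofNat_succ] at h
    have e : (Int.ofNat (n + 1) - 1 : ℤ) = Int.ofNat n := by simp
    rw [e]
    exact h
  · change l ∈ (ofNegNat (n + 1)).left at h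
    rw [ofNegNat_eq, left_neg, right_ofNat] at h
    simp at h

theorem right_ofInt {m : ℤ} {r : Game.{u}} (h : r ∈ (ofInt m).right) : r = ofInt (m + 1) := by
  rcases m with n | n
  · change r ∈ (ofNat n).right at h
    rw [right_ofNat] at h
    exact h.elim
  · change r ∈ (ofSets ∅ {ofNegNat n}).right at h
    rw [right_ofSets] at h
    obtain rfl : r = ofNegNat n := h
    rcases n with _ | n
    · rfl
    · have e : (Int.negSucc (n + 1) + 1 : ℤ) = Int.negSucc n := by omega
      rw [e]
      rfl

theorem ofDyadic_succ_of_even (p : ℕ) (j : ℤ) :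
    (ofDyadic (p + 1) (2 * j) : Game.{u}) = ofDyadic p j := by
  rw [ofDyadic, if_pos (even_two_mul j), Int.mul_ediv_cancel_left _ two_ne_zero]

theorem ofDyadic_succ_of_odd (p : ℕ) (j : ℤ) :
    (ofDyadic (p + 1) (2 * j + 1) : Game.{u}) =
      ofSets {ofDyadic p j} {ofDyadic p (j + 1)} := by
  have e : (2 * j + 1) / 2 = j := by omega
  rw [ofDyadic, if_neg (Int.not_even_two_mul_add_one j)]
  simp only [e]

/-- This covers `p = 0` too: a left option of an integer, if there is one, is its predecessor. -/
theorem left_ofDyadic {p : ℕ} {j : ℤ} {l : Game.{u}} (h : l ∈ (ofDyadic p (2 * j + 1)).left) :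
    l = ofDyadic p (2 * j) := by
  rcases p with _ | p
  · rw [left_ofInt h, add_sub_cancel_right]; rfl
  · rw [ofDyadic_succ_of_odd, left_ofSets] at h
    rw [ofDyadic_succ_of_even]
    exact h

theorem right_ofDyadic {p : ℕ} {j : ℤ} {r : Game.{u}} (h : r ∈ (ofDyadic p (2 * j + 1)).right) :
    r = ofDyadic p (2 * (j + 1)) := by
  rcases p with _ | p
  · rw [right_ofInt h, mul_add, mul_one, add_assoc]; rfl
  · rw [ofDyadic_succ_of_odd, right_ofSets] at h
    rw [ofDyadic_succ_of_even]
    exact h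

theorem val_one_pos : (0 : Value.{u}) < (ofNat 1 : Game.{u}).val := by
  rw [← val_zero, val_lt_val]
  exact (isSurreal_ofNat 1).left_lt ((left_ofNat_succ 0).symm ▸ rfl)

theorem zsmul_val_one_lt {m n : ℤ} (h : m < n) :
    m • (ofNat 1 : Game.{u}).val < n • (ofNat 1 : Game.{u}).val := by
  rw [← sub_pos, sub_eq_add_neg, ← neg_zsmul, ← add_zsmul, ← sub_eq_add_neg]
  obtain ⟨k, hk⟩ := Int.eq_ofNat_of_zero_le (sub_pos.2 h).le
  have hk0 : k ≠ 0 := by rintro rfl; simp at hk; omega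
  rw [hk, natCast_zsmul]
  exact nsmul_pos val_one_pos hk0

/-- Because surreal values have no torsion, the equation `2 ^ p • v = m • 1` determines `v`.
Addition and order of dyadics are read off from it. -/
theorem ofDyadic_spec (p : ℕ) : ∀ m : ℤ, (ofDyadic p m : Game.{u}).IsSurreal ∧
    2 ^ p • (ofDyadic p m : Game.{u}).val = m • (ofNat 1 : Game.{u}).val := by
  induction p with
  | zero =>
    intro m
    exact ⟨isSurreal_ofInt m, by rw [pow_zero, one_nsmul]; exact val_ofInt m⟩
  | succ p ih =>
    have hadd : ∀ a b : ℤ, (ofDyadic p (a + b) : Game.{u}).val =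
        (ofDyadic p a).val + (ofDyadic p b).val := by
      intro a b
      rw [← val_add]
      refine eq_of_nsmul_val_eq (ih _).1 ((ih a).1.add (ih b).1) (n := 2 ^ p) (by positivity) ?_
      rw [val_add, nsmul_add, (ih _).2, (ih _).2, (ih _).2, add_zsmul]
    intro m
    obtain ⟨j, rfl | rfl⟩ := Int.even_or_odd' m
    · rw [ofDyadic_succ_of_even]
      refine ⟨(ih j).1, ?_⟩
      rw [pow_succ, mul_nsmul, (ih j).2, two_mul, add_zsmul, two_nsmul]
    · have hlt : (ofDyadic p j : Game.{u}).val < (ofDyadic p (j + 1)).val := by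
        refine lt_of_nsmul_val_lt (ih _).1 (ih _).1 (2 ^ p) ?_
        rw [(ih _).2, (ih _).2]
        exact zsmul_val_one_lt (by omega)
      have hl := left_ofSets {ofDyadic p j} {(ofDyadic p (j + 1) : Game.{u})}
      have hr := right_ofSets {ofDyadic p j} {(ofDyadic p (j + 1) : Game.{u})}
      rw [← ofDyadic_succ_of_odd] at hl hr
      set H : Game.{u} := ofDyadic (p + 1) (2 * j + 1)
      have hH : H.IsSurreal := by
        apply isSurreal_of_lt
        · rw [hl]; rintro _ rfl; exact (ih j).1
        · rw [hr]; rintro _ rfl; exact (ih _).1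
        · rw [hl, hr]; rintro _ rfl _ rfl; exact val_lt_val.1 hlt
      have h1 : (ofDyadic p j).val < H.val := val_lt_val.2 (hH.left_lt (hl ▸ rfl))
      have h2 : H.val < (ofDyadic p (j + 1)).val := val_lt_val.2 (hH.lt_right (hr ▸ rfl))
      have hM : (ofDyadic p (2 * j + 1) : Game.{u}).val =
          (ofDyadic p j).val + (ofDyadic p (j + 1)).val := by rw [← hadd]; congr 2; ring
      -- Write `H = {d | d'}` with neighbours `d < d'` of level `p`. The claim is `H + H ≈ d + d'`:
      -- the options of `H + H` are `H + d < d' + d` and `H + d' > d + d'`, while those of the odd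
      -- dyadic are at most `2d < 2H` and `2d' > 2H`.
      have hkey : (H + H).val = (ofDyadic p (2 * j + 1)).val := by
        apply le_antisymm
        · rw [(hH.add hH).val_le_iff (ih _).1]
          constructor
          · intro l h
            rw [hM]
            rcases mem_left_add.1 h with ⟨l, h', rfl⟩ | ⟨l, h', rfl⟩ <;> rw [hl] at h' <;>
              obtain rfl := h'
            · rw [val_add]; gcongr
            · rw [val_add, add_comm]; gcongr
          · intro r h
            rw [right_ofDyadic h, two_mul, hadd, val_add]
            gcongr
        · rw [(ih _).1.val_le_iff (hH.add hH)]
          constructor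
          · intro l h
            rw [left_ofDyadic h, two_mul, hadd, val_add]
            gcongr
          · intro r h
            rw [hM]
            rcases mem_right_add.1 h with ⟨r, h', rfl⟩ | ⟨r, h', rfl⟩ <;> rw [hr] at h' <;>
              obtain rfl := h'
            · rw [val_add, add_comm]; gcongr
            · rw [val_add]; gcongr
      refine ⟨hH, ?_⟩
      rw [pow_succ', mul_nsmul, two_nsmul, ← val_add, hkey, (ih _).2]

/-- `v` is the value of the surreal dyadic number `d`. -/
def IsDyadicVal (v : Value.{u}) (d : ℝ) : Prop :=
  ∃ (p : ℕ) (j : ℤ), v = (ofDyadic p j).val ∧ d = j / 2 ^ p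

theorem ofDyadic_eq_of_eq {p q : ℕ} {j k : ℤ} (h : j * 2 ^ q = k * 2 ^ p) :
    (ofDyadic p j : Game.{u}).val = (ofDyadic q k).val := by
  refine eq_of_nsmul_val_eq (ofDyadic_spec p j).1 (ofDyadic_spec q k).1 (n := 2 ^ p * 2 ^ q)
    (by positivity) ?_
  rw [mul_nsmul, (ofDyadic_spec p j).2, mul_nsmul', (ofDyadic_spec q k).2, ← natCast_zsmul,
    ← natCast_zsmul, ← mul_zsmul, ← mul_zsmul]
  push_cast
  rw [mul_comm, h, mul_comm]

theorem ofDyadic_add (p : ℕ) (a b : ℤ) :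
    (ofDyadic p (a + b) : Game.{u}).val = (ofDyadic p a).val + (ofDyadic p b).val := by
  rw [← val_add]
  refine eq_of_nsmul_val_eq (ofDyadic_spec p _).1
    ((ofDyadic_spec p a).1.add (ofDyadic_spec p b).1) (n := 2 ^ p) (by positivity) ?_
  rw [val_add, nsmul_add, (ofDyadic_spec p _).2, (ofDyadic_spec p a).2, (ofDyadic_spec p b).2,
    add_zsmul]

theorem ofDyadic_lt {p : ℕ} {a b : ℤ} (h : a < b) :
    (ofDyadic p a : Game.{u}).val < (ofDyadic p b).val := by
  refine lt_of_nsmul_val_lt (ofDyadic_spec p a).1 (ofDyadic_spec p b).1 (2 ^ p) ?_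
  rw [(ofDyadic_spec p a).2, (ofDyadic_spec p b).2]
  exact zsmul_val_one_lt h

theorem ofDyadic_le {p : ℕ} {a b : ℤ} (h : a ≤ b) :
    (ofDyadic p a : Game.{u}).val ≤ (ofDyadic p b).val := by
  rcases h.eq_or_lt with rfl | h
  exacts [le_rfl, (ofDyadic_lt h).le]

theorem IsDyadicVal.common {v w : Value.{u}} {d e : ℝ} (hv : IsDyadicVal v d)
    (hw : IsDyadicVal w e) : ∃ (p : ℕ) (j k : ℤ), v = (ofDyadic p j).val ∧ d = j / 2 ^ p ∧
      w = (ofDyadic p k).val ∧ e = k / 2 ^ p := by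
  obtain ⟨p, j, rfl, rfl⟩ := hv
  obtain ⟨q, k, rfl, rfl⟩ := hw
  refine ⟨p + q, j * 2 ^ q, k * 2 ^ p, ofDyadic_eq_of_eq (by ring), ?_,
    ofDyadic_eq_of_eq (by ring), ?_⟩
  · push_cast
    field_simp
    ring
  · push_cast
    field_simp
    ring

theorem IsDyadicVal.sub {v w : Value.{u}} {d e : ℝ} (hv : IsDyadicVal v d)
    (hw : IsDyadicVal w e) : IsDyadicVal (v - w) (d - e) := by
  obtain ⟨p, j, k, rfl, rfl, rfl, rfl⟩ := hv.common hw
  refine ⟨p, j - k, ?_, by push_cast; ring⟩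
  rw [sub_eq_iff_eq_add, ← ofDyadic_add, sub_add_cancel]

theorem IsDyadicVal.add {v w : Value.{u}} {d e : ℝ} (hv : IsDyadicVal v d)
    (hw : IsDyadicVal w e) : IsDyadicVal (v + w) (d + e) := by
  obtain ⟨p, j, k, rfl, rfl, rfl, rfl⟩ := hv.common hw
  exact ⟨p, j + k, (ofDyadic_add _ _ _).symm, by push_cast; ring⟩

theorem IsDyadicVal.lt {v w : Value.{u}} {d e : ℝ} (hv : IsDyadicVal v d)
    (hw : IsDyadicVal w e) (h : d < e) : v < w := by
  obtain ⟨p, j, k, rfl, rfl, rfl, rfl⟩ := hv.common hw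
  rw [div_lt_div_iff_of_pos_right (by positivity)] at h
  exact ofDyadic_lt (by exact_mod_cast h)

theorem exists_isDyadicVal_between {a b : ℝ} (h : a < b) :
    ∃ (v : Value.{u}) (d : ℝ), IsDyadicVal v d ∧ a < d ∧ d < b := by
  obtain ⟨p, hp⟩ := pow_unbounded_of_one_lt (1 / (b - a)) one_lt_two
  have hp' : (0 : ℝ) < 2 ^ p := by positivity
  rw [div_lt_iff₀ (sub_pos.2 h)] at hp
  refine ⟨_, _, ⟨p, ⌊a * 2 ^ p⌋ + 1, rfl, rfl⟩, ?_, ?_⟩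
  · rw [lt_div_iff₀ hp']
    push_cast
    exact Int.lt_floor_add_one _
  · rw [div_lt_iff₀ hp']
    push_cast
    have := Int.floor_le (a * 2 ^ p)
    nlinarith

/-! ### Real numbers -/

/-- The surreal whose canonical representative is `s_ℝ(r)`. -/
noncomputable def cutReal (r : ℝ) : Game.{u} :=
  ofSets (Set.range fun n : ℕ => ofDyadic n ⌈r * 2 ^ n - 1⌉)
    (Set.range fun n : ℕ => ofDyadic n ⌊r * 2 ^ n + 1⌋)

theorem left_cutReal (r : ℝ) : (cutReal r : Game.{u}).left =
    Set.range fun n : ℕ => ofDyadic n ⌈r * 2 ^ n - 1⌉ := left_ofSets _ _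

theorem right_cutReal (r : ℝ) : (cutReal r : Game.{u}).right =
    Set.range fun n : ℕ => ofDyadic n ⌊r * 2 ^ n + 1⌋ := right_ofSets _ _

theorem isDyadicVal_left_cutReal {r : ℝ} {l : Game.{u}} (h : l ∈ (cutReal r).left) :
    ∃ d, IsDyadicVal l.val d ∧ d < r := by
  rw [left_cutReal] at h
  obtain ⟨n, rfl⟩ := h
  refine ⟨_, ⟨n, _, rfl, rfl⟩, ?_⟩
  rw [div_lt_iff₀ (by positivity)]
  have := Int.ceil_lt_add_one (r * 2 ^ n - 1)
  linarith

theorem isDyadicVal_right_cutReal {r : ℝ} {l : Game.{u}} (h : l ∈ (cutReal r).right) :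
    ∃ d, IsDyadicVal l.val d ∧ r < d := by
  rw [right_cutReal] at h
  obtain ⟨n, rfl⟩ := h
  refine ⟨_, ⟨n, _, rfl, rfl⟩, ?_⟩
  rw [lt_div_iff₀ (by positivity)]
  have := Int.lt_floor_add_one (r * 2 ^ n + 1)
  linarith

theorem isSurreal_cutReal (r : ℝ) : (cutReal r : Game.{u}).IsSurreal := by
  apply isSurreal_of_lt
  · rw [left_cutReal]; rintro _ ⟨n, rfl⟩; exact (ofDyadic_spec _ _).1
  · rw [right_cutReal]; rintro _ ⟨n, rfl⟩; exact (ofDyadic_spec _ _).1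
  · intro l hl s hs
    obtain ⟨d, hd, hdr⟩ := isDyadicVal_left_cutReal hl
    obtain ⟨e, he, hre⟩ := isDyadicVal_right_cutReal hs
    exact val_lt_val.1 (hd.lt he (hdr.trans hre))

/-- The integer `⌈r * 2 ^ p - 1⌉` is the largest one strictly below `r * 2 ^ p`, so the left options
are cofinal among the dyadics below `r`. -/
theorem IsDyadicVal.lt_cutReal {v : Value.{u}} {d r : ℝ} (hv : IsDyadicVal v d) (h : d < r) :
    v < (cutReal r).val := by
  obtain ⟨p, j, rfl, rfl⟩ := hv
  have hj : j ≤ ⌈r * 2 ^ p - 1⌉ := by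
    rw [div_lt_iff₀ (by positivity)] at h
    have := Int.lt_ceil.2 h
    rw [Int.ceil_sub_one]
    omega
  refine (ofDyadic_le hj).trans_lt (val_lt_val.2 ((isSurreal_cutReal r).left_lt ?_))
  rw [left_cutReal]
  exact ⟨p, rfl⟩

theorem IsDyadicVal.cutReal_lt {v : Value.{u}} {d r : ℝ} (hv : IsDyadicVal v d) (h : r < d) :
    (cutReal r).val < v := by
  obtain ⟨p, j, rfl, rfl⟩ := hv
  have hj : ⌊r * 2 ^ p + 1⌋ ≤ j := by
    rw [lt_div_iff₀ (by positivity)] at h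
    have := Int.floor_lt.2 h
    rw [Int.floor_add_one]
    omega
  refine (val_lt_val.2 ((isSurreal_cutReal r).lt_right ?_)).trans_le (ofDyadic_le hj)
  rw [right_cutReal]
  exact ⟨p, rfl⟩

theorem cutReal_lt {r s : ℝ} (h : r < s) : (cutReal r : Game.{u}).val < (cutReal s).val := by
  obtain ⟨v, d, hv, h₁, h₂⟩ := exists_isDyadicVal_between.{u} h
  exact (hv.cutReal_lt h₁).trans (hv.lt_cutReal h₂)

/-- A dyadic `e` with `d - s < e < r` splits `d` as `e + (d - e)`, with the parts below `r` and `s`.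
-/
theorem IsDyadicVal.lt_cutReal_add {v : Value.{u}} {d r s : ℝ} (hv : IsDyadicVal v d)
    (h : d < r + s) : v < (cutReal r).val + (cutReal s).val := by
  obtain ⟨w, e, hw, h₁, h₂⟩ := exists_isDyadicVal_between.{u} (sub_lt_iff_lt_add.2 h)
  rw [← add_sub_cancel w v]
  exact add_lt_add (hw.lt_cutReal h₂) ((hv.sub hw).lt_cutReal (by linarith))

theorem IsDyadicVal.cutReal_add_lt {v : Value.{u}} {d r s : ℝ} (hv : IsDyadicVal v d)
    (h : r + s < d) : (cutReal r).val + (cutReal s).val < v := by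
  obtain ⟨w, e, hw, h₁, h₂⟩ := exists_isDyadicVal_between.{u} (lt_sub_iff_add_lt.2 h)
  rw [← add_sub_cancel w v]
  exact add_lt_add (hw.cutReal_lt h₁) ((hv.sub hw).cutReal_lt (by linarith))

theorem IsDyadicVal.add_cutReal_lt {v : Value.{u}} {d r s : ℝ} (hv : IsDyadicVal v d)
    (h : d < r) : v + (cutReal s).val < (cutReal (r + s)).val := by
  obtain ⟨w, e, hw, h₁, h₂⟩ := exists_isDyadicVal_between.{u}
    (show s < r + s - d by linarith)
  exact (add_lt_add_right (hw.cutReal_lt h₁) v).trans ((hv.add hw).lt_cutReal (by linarith))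

theorem IsDyadicVal.lt_add_cutReal {v : Value.{u}} {d r s : ℝ} (hv : IsDyadicVal v d)
    (h : r < d) : (cutReal (r + s)).val < v + (cutReal s).val := by
  obtain ⟨w, e, hw, h₁, h₂⟩ := exists_isDyadicVal_between.{u}
    (show r + s - d < s by linarith)
  exact ((hv.add hw).cutReal_lt (by linarith)).trans (add_lt_add_right (hw.lt_cutReal h₂) v)

/-- Options of the cuts are dyadics strictly on one side of `r`, `s` or `r + s`. Each comparison of
an option with the other side then follows by inserting a further dyadic in the gap. -/
theorem val_cutReal_add (r s : ℝ) :
    (cutReal (r + s) : Game.{u}).val = (cutReal r).val + (cutReal s).val := by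
  have hr : (cutReal r : Game.{u}).IsSurreal := isSurreal_cutReal r
  have hs : (cutReal s : Game.{u}).IsSurreal := isSurreal_cutReal s
  have hrs : (cutReal (r + s) : Game.{u}).IsSurreal := isSurreal_cutReal _
  rw [← val_add]
  apply le_antisymm
  · rw [hrs.val_le_iff (hr.add hs)]
    constructor
    · intro l hl
      obtain ⟨d, hd, h⟩ := isDyadicVal_left_cutReal hl
      exact hd.lt_cutReal_add h
    · intro t ht
      rcases mem_right_add.1 ht with ⟨t, ht', rfl⟩ | ⟨t, ht', rfl⟩
      · obtain ⟨d, hd, h⟩ := isDyadicVal_right_cutReal ht'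
        exact hd.lt_add_cutReal h
      · obtain ⟨d, hd, h⟩ := isDyadicVal_right_cutReal ht'
        rw [val_add, add_comm r, add_comm (cutReal r).val]
        exact hd.lt_add_cutReal h
  · rw [(hr.add hs).val_le_iff hrs]
    constructor
    · intro t ht
      rcases mem_left_add.1 ht with ⟨t, ht', rfl⟩ | ⟨t, ht', rfl⟩
      · obtain ⟨d, hd, h⟩ := isDyadicVal_left_cutReal ht'
        exact hd.add_cutReal_lt h
      · obtain ⟨d, hd, h⟩ := isDyadicVal_left_cutReal ht'
        rw [val_add, add_comm r, add_comm (cutReal r).val]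
        exact hd.add_cutReal_lt h
    · intro l hl
      obtain ⟨d, hd, h⟩ := isDyadicVal_right_cutReal hl
      exact hd.cutReal_add_lt h

theorem isDyadicVal_ofNat (n : ℕ) : IsDyadicVal (ofNat n : Game.{u}).val n :=
  ⟨0, n, rfl, by simp⟩

theorem val_cutReal_one : (cutReal 1 : Game.{u}).val = (ofNat 1 : Game.{u}).val := by
  apply le_antisymm
  · rw [(isSurreal_cutReal 1).val_le_iff (isSurreal_ofNat 1)]
    refine ⟨fun l hl => ?_, by simp [right_ofNat]⟩
    obtain ⟨d, hd, h⟩ := isDyadicVal_left_cutReal hl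
    exact hd.lt (isDyadicVal_ofNat 1) (by simpa)
  · rw [(isSurreal_ofNat 1).val_le_iff (isSurreal_cutReal 1)]
    constructor
    · rw [left_ofNat_succ]
      rintro _ rfl
      exact (isDyadicVal_ofNat 0).lt_cutReal (by simp)
    · intro r hr
      obtain ⟨d, hd, h⟩ := isDyadicVal_right_cutReal hr
      exact (isDyadicVal_ofNat 1).lt hd (by simpa)

theorem isSurreal_ofReal (r : ℝ) : (ofReal r : Game.{u}).IsSurreal := (isSurreal_cutReal r).uniq

theorem val_ofReal (r : ℝ) : (ofReal r : Game.{u}).val = (cutReal r).val :=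
  val_eq_val.2 (isSurreal_cutReal r).uniq_equiv

theorem ofReal_lt {r s : ℝ} (h : r < s) : (ofReal r : Game.{u}) < ofReal s := by
  rw [← val_lt_val, val_ofReal, val_ofReal]
  exact cutReal_lt h

/-- Multiplication of real numbers by a fixed surreal number. -/
noncomputable def IsSurreal.realMul {w : Game.{u}} (hw : w.IsSurreal) :
    ℝ →+ surrealSubgroup.{u} :=
  AddMonoidHom.mk' (fun r => ((isSurreal_ofReal r).mul hw).toVal) <| by
    intro r s
    apply Subtype.ext
    change (ofReal (r + s) * w).val = (ofReal r * w).val + (ofReal s * w).val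
    rw [← val_add_mul]
    refine val_mul_congr_left (isSurreal_ofReal _) ((isSurreal_ofReal r).add (isSurreal_ofReal s))
      hw ?_
    rw [val_add, val_ofReal, val_ofReal, val_ofReal, val_cutReal_add]

theorem IsSurreal.realMul_one {w : Game.{u}} (hw : w.IsSurreal) : hw.realMul 1 = hw.toVal := by
  apply Subtype.ext
  change (ofReal 1 * w).val = w.val
  rw [val_mul_congr_left (isSurreal_ofReal 1) (isSurreal_ofNat 1) hw
    (by rw [val_ofReal, val_cutReal_one]), ofNat_one_mul]

theorem IsSurreal.realMul_strictMono {w : Game.{u}} (hw : w.IsSurreal) (h : 0 < w) :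
    StrictMono hw.realMul :=
  fun r s hrs => val_mul_lt_mul_right (isSurreal_ofReal r) (isSurreal_ofReal s) hw (ofReal_lt hrs) h

theorem val_ofInt_mul {x : Game.{u}} (hx : x.IsSurreal) (n : ℕ) :
    (ofInt (n : ℤ) * x).val = n • x.val := by
  change (ofNat n * x).val = _
  induction n with
  | zero =>
    rw [zero_nsmul]
    exact congrArg val (zero_mul' x)
  | succ n ih =>
    rw [val_mul_congr_left (isSurreal_ofNat _) ((isSurreal_ofNat n).add (isSurreal_ofNat 1)) hx
      (val_ofNat_succ n), val_add_mul, ih, ofNat_one_mul, succ_nsmul]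

/-! ### Powers of `ω` -/

theorem mem_left_omegaPow {x z : Game.{u}} : z ∈ x.omegaPow.left ↔
    z = 0 ∨ ∃ r : ℝ, 0 < r ∧ ∃ l ∈ x.left, ofReal r * l.omegaPow = z := by
  rw [omegaPow, left_ofSets]
  simp only [Set.mem_union, Set.mem_singleton_iff, Set.mem_range, Prod.exists, Subtype.exists,
    Set.mem_Ioi, exists_prop]

theorem mem_right_omegaPow {x z : Game.{u}} : z ∈ x.omegaPow.right ↔
    ∃ r : ℝ, 0 < r ∧ ∃ l ∈ x.right, ofReal r * l.omegaPow = z := by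
  rw [omegaPow, right_ofSets]
  simp only [Set.mem_range, Prod.exists, Subtype.exists, Set.mem_Ioi, exists_prop]

/-- Every positive real multiple of `a` is less than every positive real multiple of `b`. -/
def RealMulLT (a b : Game.{u}) : Prop :=
  ∀ r s : ℝ, 0 < r → 0 < s → (ofReal r * a).val < (ofReal s * b).val

theorem ofReal_one_mul {w : Game.{u}} (hw : w.IsSurreal) : (ofReal 1 * w).val = w.val :=
  congrArg Subtype.val hw.realMul_one

theorem ofReal_mul_pos {w : Game.{u}} (hw : w.IsSurreal) (h : 0 < w) {r : ℝ} (hr : 0 < r) :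
    0 < (ofReal r * w).val := by
  have : hw.realMul 0 < hw.realMul r := hw.realMul_strictMono h hr
  rw [map_zero] at this
  exact this

theorem ofReal_mul_lt_iff {a b : Game.{u}} (ha : a.IsSurreal) (hb : b.IsSurreal) (hb0 : 0 < b) :
    RealMulLT a b ↔ ∀ r : ℝ, 0 < r → (ofReal r * a).val < b.val := by
  constructor
  · intro h r hr
    rw [← ofReal_one_mul hb]
    exact h r 1 hr one_pos
  · intro h r s hr hs
    -- Since `n * s > 1`, the inequalities `n·r·a < b < n·s·b` hold, and `n` cancels.
    obtain ⟨n, hn⟩ := exists_nat_gt (1 / s)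
    have hn0 : (0 : ℝ) < n := lt_trans (by positivity) hn
    have h1 := h (n * r) (by positivity)
    have h2 : (hb.realMul 1) < n • hb.realMul s := by
      rw [← map_nsmul]
      apply hb.realMul_strictMono hb0
      rw [nsmul_eq_mul]
      rwa [div_lt_iff₀ hs] at hn
    have h3 : ha.realMul (n * r) < hb.toVal := h1
    rw [← nsmul_eq_mul, map_nsmul] at h3
    rw [hb.realMul_one] at h2
    exact lt_of_nsmul_lt_nsmul_right n (h3.trans h2)

theorem omegaPow_pos {x : Game.{u}} (h : x.omegaPow.IsSurreal) : 0 < x.omegaPow :=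
  h.left_lt (mem_left_omegaPow.2 (Or.inl rfl))

theorem realMulLT_left {x l : Game.{u}} (h : x.omegaPow.IsSurreal) (h' : l.omegaPow.IsSurreal)
    (hl : l ∈ x.left) : RealMulLT l.omegaPow x.omegaPow :=
  (ofReal_mul_lt_iff h' h (omegaPow_pos h)).2 fun r hr =>
    val_lt_val.2 (h.left_lt (mem_left_omegaPow.2 (Or.inr ⟨r, hr, l, hl, rfl⟩)))

theorem realMulLT_right {x t : Game.{u}} (h : x.omegaPow.IsSurreal) (h' : t.omegaPow.IsSurreal)
    (ht : t ∈ x.right) : RealMulLT x.omegaPow t.omegaPow := by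
  have key : ∀ s : ℝ, 0 < s → x.omegaPow.val < (ofReal s * t.omegaPow).val := fun s hs =>
    val_lt_val.2 (h.lt_right (mem_right_omegaPow.2 ⟨s, hs, t, ht, rfl⟩))
  intro r s hr hs
  -- The right options with coefficient `s / n` give `n·ω^x < s·ω^t`, and `r·ω^x < n·ω^x`.
  obtain ⟨n, hn⟩ := exists_nat_gt r
  have hn0 : (0 : ℝ) < n := hr.trans hn
  have h1 : h.toVal < h'.realMul (s / n) := key (s / n) (by positivity)
  have hn0' : n ≠ 0 := fun h => by simp [h] at hn0
  have h2 := nsmul_lt_nsmul_right hn0' h1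
  rw [← map_nsmul, nsmul_eq_mul, mul_div_cancel₀ _ hn0.ne', ← h.realMul_one, ← map_nsmul,
    nsmul_one] at h2
  exact (h.realMul_strictMono (omegaPow_pos h) hn).trans h2

theorem RealMulLT.trans {a b c : Game.{u}} (h : RealMulLT a b) (h' : RealMulLT b c) :
    RealMulLT a c :=
  fun r s hr hs => (h r 1 hr one_pos).trans (h' 1 s one_pos hs)

theorem RealMulLT.congr {a a' b b' : Game.{u}} (h : RealMulLT a b) (ha : a.IsSurreal)
    (ha' : a'.IsSurreal) (hb : b.IsSurreal) (hb' : b'.IsSurreal) (e : a.val = a'.val)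
    (e' : b.val = b'.val) : RealMulLT a' b' := by
  intro r s hr hs
  rw [← val_mul_congr (isSurreal_ofReal r) (isSurreal_ofReal r) ha ha' rfl e,
    ← val_mul_congr (isSurreal_ofReal s) (isSurreal_ofReal s) hb hb' rfl e']
  exact h r s hr hs

theorem isSurreal_omegaPow_of {x : Game.{u}} (hL : ∀ l ∈ x.left, l.omegaPow.IsSurreal)
    (hR : ∀ l ∈ x.right, l.omegaPow.IsSurreal)
    (h : ∀ l ∈ x.left, ∀ r ∈ x.right, RealMulLT l.omegaPow r.omegaPow) :
    x.omegaPow.IsSurreal := by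
  apply isSurreal_of_lt
  · intro z hz
    rcases mem_left_omegaPow.1 hz with rfl | ⟨r, hr, l, hl, rfl⟩
    · exact isSurreal_zero
    · exact (isSurreal_ofReal r).mul (hL l hl)
  · intro z hz
    obtain ⟨r, hr, l, hl, rfl⟩ := mem_right_omegaPow.1 hz
    exact (isSurreal_ofReal r).mul (hR l hl)
  · intro z hz w hw
    obtain ⟨s, hs, t, ht, rfl⟩ := mem_right_omegaPow.1 hw
    rcases mem_left_omegaPow.1 hz with rfl | ⟨r, hr, l, hl, rfl⟩
    · exact val_lt_val.1 (ofReal_mul_pos (hR t ht) (omegaPow_pos (hR t ht)) hs)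
    · exact val_lt_val.1 (h l hl t ht r s hr hs)

/-- The monotonicity of `x ↦ ω ^ x` at a pair of surreals. -/
def OmegaMono (x y : Game.{u}) : Prop :=
  (x ≤ y → x.omegaPow.val ≤ y.omegaPow.val) ∧ (x < y → RealMulLT x.omegaPow y.omegaPow)

/-- The weak part compares `ω^x` and `ω^y` with each other's options. The strict part interpolates
an option between `x` and `y`: the step from an option to its own game is built into the cut, and
the other step is inductive, or an equivalence of powers. -/
theorem omegaMono_of {x y : Game.{u}} (hx : x.IsSurreal) (hy : y.IsSurreal)
    (nx : x.omegaPow.IsSurreal) (ny : y.omegaPow.IsSurreal)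
    (hopt : ∀ o, IsOption o x ∨ IsOption o y → o.omegaPow.IsSurreal)
    (h₁ : ∀ o, IsOption o x → OmegaMono o y ∧ OmegaMono y o)
    (h₂ : ∀ o, IsOption o y → OmegaMono x o ∧ OmegaMono o x) : OmegaMono x y := by
  constructor
  · intro hxy
    rw [nx.val_le_iff ny]
    constructor
    · intro z hz
      rcases mem_left_omegaPow.1 hz with rfl | ⟨r, hr, l, hl, rfl⟩
      · exact val_lt_val.2 (omegaPow_pos ny)
      · have := ((h₁ l (Or.inl hl)).1.2 ((hx.left_lt hl).trans_le hxy)) r 1 hr one_pos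
        rwa [ofReal_one_mul ny] at this
    · intro z hz
      obtain ⟨s, hs, t, ht, rfl⟩ := mem_right_omegaPow.1 hz
      have := ((h₂ t (Or.inr ht)).1.2 (hxy.trans_lt (hy.lt_right ht))) 1 s one_pos hs
      rwa [ofReal_one_mul nx] at this
  · intro hxy
    rcases not_le_iff.1 hxy.2 with ⟨l, hl, hle⟩ | ⟨t, ht, hle⟩
    · have nl := hopt l (Or.inr (Or.inl hl))
      have hm := realMulLT_left ny nl hl
      by_cases hle' : l ≤ x
      · refine hm.congr nl nx ny ny (le_antisymm ?_ ?_) rfl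
        · exact (h₂ l (Or.inl hl)).2.1 hle'
        · exact (h₂ l (Or.inl hl)).1.1 hle
      · exact ((h₂ l (Or.inl hl)).1.2 ⟨hle, hle'⟩).trans hm
    · have nt := hopt t (Or.inl (Or.inr ht))
      have hm := realMulLT_right nx nt ht
      by_cases hle' : y ≤ t
      · refine hm.congr nx nx nt ny rfl (le_antisymm ?_ ?_)
        · exact (h₁ t (Or.inr ht)).1.1 hle
        · exact (h₁ t (Or.inr ht)).2.1 hle'
      · exact hm.trans ((h₁ t (Or.inr ht)).1.2 ⟨hle, hle'⟩)

theorem omegaMono_and {x y : Game.{u}} (hx : x.IsSurreal) (hy : y.IsSurreal)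
    (nx : x.omegaPow.IsSurreal) (ny : y.omegaPow.IsSurreal)
    (hxo : ∀ o, IsOption o x → o.omegaPow.IsSurreal)
    (hyo : ∀ o, IsOption o y → o.omegaPow.IsSurreal)
    (h₁ : ∀ o, IsOption o x → OmegaMono o y ∧ OmegaMono y o)
    (h₂ : ∀ o, IsOption o y → OmegaMono x o ∧ OmegaMono o x) : OmegaMono x y ∧ OmegaMono y x :=
  ⟨omegaMono_of hx hy nx ny (fun o ho => ho.elim (hxo o) (hyo o)) h₁ h₂,
    omegaMono_of hy hx ny nx (fun o ho => ho.elim (hyo o) (hxo o))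
      (fun o ho => (h₂ o ho).symm) fun o ho => (h₁ o ho).symm⟩

/-- Surreality of `ω^x` uses strict monotonicity at pairs of options of `x`, all of rank below `α`.
Monotonicity at rank up to `α` can then assume surreality there and runs a lexicographic induction
on the pair. -/
theorem omegaPow_induction (α : Ordinal.{u + 1}) :
    (∀ x : Game.{u}, x.rank ≤ α → x.IsSurreal → x.omegaPow.IsSurreal) ∧
      ∀ x y : Game.{u}, x.rank ≤ α → y.rank ≤ α → x.IsSurreal → y.IsSurreal →
        OmegaMono x y ∧ OmegaMono y x := by
  induction α using WellFoundedLT.induction with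
  | _ α ih =>
    have hN : ∀ x : Game.{u}, x.rank ≤ α → x.IsSurreal → x.omegaPow.IsSurreal := by
      intro x hxα hx
      have hopt : ∀ o, IsOption o x → o.omegaPow.IsSurreal := fun o ho =>
        (ih o.rank (ho.rank_lt.trans_le hxα)).1 o le_rfl (hx.of_isOption ho)
      refine isSurreal_omegaPow_of (fun l hl => hopt l (Or.inl hl))
        (fun l hl => hopt l (Or.inr hl)) fun l hl r hr => ?_
      have h1 := IsOption.rank_lt (Or.inl hl)
      have h2 := IsOption.rank_lt (Or.inr hr)
      -- Bounding ranks by `α`, instead of fixing them, lets the maximum of the two ranks serve as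
      -- the smaller parameter.
      exact ((ih (max l.rank r.rank) ((max_lt h1 h2).trans_le hxα)).2 l r (le_max_left _ _)
        (le_max_right _ _) (hx.of_left hl) (hx.of_right hr)).1.2
        ((hx.left_lt hl).trans (hx.lt_right hr))
    refine ⟨hN, ?_⟩
    have main : ∀ p : Game.{u} × Game.{u}, p.1.rank ≤ α → p.2.rank ≤ α → p.1.IsSurreal →
        p.2.IsSurreal → OmegaMono p.1 p.2 ∧ OmegaMono p.2 p.1 := by
      intro p
      induction p using (WellFounded.prod_lex isOption_wf isOption_wf).induction with
      | _ p ih' =>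
        obtain ⟨x, y⟩ := p
        intro hxα hyα hx hy
        have hxo : ∀ o, IsOption o x → o.rank ≤ α := fun o ho => (ho.rank_lt.trans_le hxα).le
        have hyo : ∀ o, IsOption o y → o.rank ≤ α := fun o ho => (ho.rank_lt.trans_le hyα).le
        exact omegaMono_and hx hy (hN x hxα hx) (hN y hyα hy)
          (fun o ho => hN o (hxo o ho) (hx.of_isOption ho))
          (fun o ho => hN o (hyo o ho) (hy.of_isOption ho))
          (fun o ho => ih' (o, y) (Prod.Lex.left _ _ ho) (hxo o ho) hyα (hx.of_isOption ho) hy)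
          fun o ho => ih' (x, o) (Prod.Lex.right _ ho) hxα (hyo o ho) hx (hy.of_isOption ho)
    exact fun x y => main (x, y)

theorem IsSurreal.omegaPow {x : Game.{u}} (hx : x.IsSurreal) : x.omegaPow.IsSurreal :=
  (omegaPow_induction x.rank).1 x le_rfl hx

theorem IsSurreal.omegaMono {x y : Game.{u}} (hx : x.IsSurreal) (hy : y.IsSurreal) :
    OmegaMono x y :=
  ((omegaPow_induction (max x.rank y.rank)).2 x y (le_max_left _ _) (le_max_right _ _) hx hy).1

/-! ### Leaders -/

/-- `a` is less than a natural multiple of `b`. -/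
def BoundedBy (a b : Value.{u}) : Prop := ∃ n : ℕ, a < n • b

theorem BoundedBy.trans {a b c : Value.{u}} (h : BoundedBy a b) (h' : BoundedBy b c) :
    BoundedBy a c := by
  obtain ⟨n, hn⟩ := h
  obtain ⟨m, hm⟩ := h'
  refine ⟨m * n, hn.trans_le ?_⟩
  rw [mul_nsmul]
  exact nsmul_le_nsmul_right hm.le n

theorem BoundedBy.trans_le {a b c : Value.{u}} (h : BoundedBy a b) (h' : b ≤ c) :
    BoundedBy a c := by
  obtain ⟨n, hn⟩ := h
  exact ⟨n, hn.trans_le (nsmul_le_nsmul_right h' n)⟩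

theorem BoundedBy.of_le {a b c : Value.{u}} (h' : a ≤ b) (h : BoundedBy b c) :
    BoundedBy a c := by
  obtain ⟨n, hn⟩ := h
  exact ⟨n, h'.trans_lt hn⟩

theorem boundedBy_of_lt {a b : Value.{u}} (h : a < b) : BoundedBy a b := ⟨1, by rwa [one_nsmul]⟩

theorem RealMulLT.not_boundedBy {a b : Game.{u}} (h : RealMulLT a b) (ha : a.IsSurreal)
    (hb : b.IsSurreal) (ha0 : 0 < a) : ¬ BoundedBy b.val a.val := by
  rintro ⟨n, hn⟩
  have hn' : hb.toVal < n • ha.toVal := hn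
  have h1 : ha.realMul (n + 1) < hb.realMul 1 := h (n + 1) 1 (by positivity) one_pos
  rw [hb.realMul_one] at h1
  rw [← ha.realMul_one, ← map_nsmul, nsmul_one] at hn'
  exact (h1.trans hn').not_gt (ha.realMul_strictMono ha0 (lt_add_one _))

theorem boundedBy_ofReal_mul_left {w : Game.{u}} (hw : w.IsSurreal) (h : 0 < w) (r : ℝ) :
    BoundedBy (ofReal r * w).val w.val := by
  obtain ⟨n, hn⟩ := exists_nat_gt r
  refine ⟨n, ?_⟩
  have h1 := hw.realMul_strictMono h hn
  rw [← nsmul_one, map_nsmul, hw.realMul_one] at h1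
  exact h1

theorem boundedBy_ofReal_mul_right {w : Game.{u}} (hw : w.IsSurreal) (h : 0 < w) {r : ℝ}
    (hr : 0 < r) : BoundedBy w.val (ofReal r * w).val := by
  obtain ⟨n, hn⟩ := exists_nat_gt (1 / r)
  refine ⟨n, ?_⟩
  rw [div_lt_iff₀ hr] at hn
  have h1 := hw.realMul_strictMono h hn
  rw [← nsmul_eq_mul, map_nsmul, hw.realMul_one] at h1
  exact h1

theorem IsSurreal.val_lt_of_not_le {x y : Game.{u}} (hx : x.IsSurreal) (hy : y.IsSurreal)
    (h : ¬ y.val ≤ x.val) : x.val < y.val := by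
  rw [val_le_val] at h
  exact val_lt_val.2 ((hx.lt_iff_not_le hy).2 h)

/-- The case of `x` incommensurate with all its positive options, each of which has a commensurate
power with exponent `Y o`. These exponents form the cut `y`. Real multiples of `ω^(Y o)` stay on the
same side of `x` as `o`, and `o` stays on the same side of `ω^y` as `ω^(Y o)`; hence the cuts `ω^y`
and `x` agree. -/
theorem exists_omegaPow_of_options {x : Game.{u}} (hx : x.IsSurreal) (h0 : 0 < x)
    (Y : Game.{u} → Game.{u}) (hY : ∀ o, IsOption o x → 0 < o → (Y o).IsSurreal ∧
      BoundedBy o.val (Y o).omegaPow.val ∧ BoundedBy (Y o).omegaPow.val o.val)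
    (hL : ∀ l ∈ x.left, 0 < l → ¬ BoundedBy x.val l.val)
    (hR : ∀ r ∈ x.right, ¬ BoundedBy r.val x.val) :
    ∃ y : Game.{u}, y.IsSurreal ∧ y.omegaPow.val = x.val := by
  have hsub : {l | l ∈ x.left ∧ 0 < l} ⊆ x.left := fun l hl => hl.1
  have : Small.{u} (Y '' {l | l ∈ x.left ∧ 0 < l}) := small_subset (Set.image_mono hsub)
  let y : Game.{u} := ofSets (Y '' {l | l ∈ x.left ∧ 0 < l}) (Y '' x.right)
  have hyl : y.left = Y '' {l | l ∈ x.left ∧ 0 < l} := left_ofSets _ _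
  have hyr : y.right = Y '' x.right := right_ofSets _ _
  have hYL := fun l (hl : l ∈ x.left) => hY l (Or.inl hl)
  have hYR := fun r (hr : r ∈ x.right) => hY r (Or.inr hr) (h0.trans (hx.lt_right hr))
  have hy : y.IsSurreal := by
    apply isSurreal_of_lt
    · rw [hyl]; rintro _ ⟨l, hl, rfl⟩; exact (hYL l hl.1 hl.2).1
    · rw [hyr]; rintro _ ⟨r, hr, rfl⟩; exact (hYR r hr).1
    · rw [hyl, hyr]
      rintro _ ⟨l, hl, rfl⟩ _ ⟨r, hr, rfl⟩
      obtain ⟨sl, l₁, l₂⟩ := hYL l hl.1 hl.2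
      obtain ⟨sr, r₁, r₂⟩ := hYR r hr
      rw [sl.lt_iff_not_le sr]
      intro h
      exact hR r hr (((r₁.trans_le ((sr.omegaMono sl).1 h)).trans l₂).trans_le
        (val_le_val.2 (hx.left_lt hl.1).le))
  have sy := hy.omegaPow
  refine ⟨y, hy, le_antisymm ?_ ?_⟩
  · rw [sy.val_le_iff hx]
    constructor
    · intro z hz
      rcases mem_left_omegaPow.1 hz with rfl | ⟨s, hs, t, ht, rfl⟩
      · exact val_lt_val.2 h0
      · rw [hyl] at ht
        obtain ⟨l, hl, rfl⟩ := ht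
        obtain ⟨sl, l₁, l₂⟩ := hYL l hl.1 hl.2
        refine IsSurreal.val_lt_of_not_le ((isSurreal_ofReal s).mul sl.omegaPow) hx fun h => ?_
        exact hL l hl.1 hl.2 (((boundedBy_ofReal_mul_left sl.omegaPow
          (omegaPow_pos sl.omegaPow) s).trans l₂).of_le h)
    · intro r hr
      obtain ⟨sr, r₁, r₂⟩ := hYR r hr
      refine sy.val_lt_of_not_le (hx.of_right hr) fun h => ?_
      refine (realMulLT_right sy sr.omegaPow (hyr ▸ ⟨r, hr, rfl⟩)).not_boundedBy sy sr.omegaPow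
        (omegaPow_pos sy) (r₂.trans_le h)
  · rw [hx.val_le_iff sy]
    constructor
    · intro l hl
      by_cases hl0 : 0 < l
      · obtain ⟨sl, l₁, l₂⟩ := hYL l hl hl0
        refine (hx.of_left hl).val_lt_of_not_le sy fun h => ?_
        exact (realMulLT_left sy sl.omegaPow (hyl ▸ ⟨l, ⟨hl, hl0⟩, rfl⟩)).not_boundedBy
          sl.omegaPow sy (omegaPow_pos sl.omegaPow) (l₁.of_le h)
      -- Left options that are not positive were left out of `y`; the explicit left option `0` of
      -- `ω^y` dominates them.
      · rw [isSurreal_zero.lt_iff_not_le (hx.of_left hl), not_not] at hl0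
        exact val_lt_val.2 (hl0.trans_lt (omegaPow_pos sy))
    · intro z hz
      obtain ⟨s, hs, t, ht, rfl⟩ := mem_right_omegaPow.1 hz
      rw [hyr] at ht
      obtain ⟨r, hr, rfl⟩ := ht
      obtain ⟨sr, r₁, r₂⟩ := hYR r hr
      refine hx.val_lt_of_not_le ((isSurreal_ofReal s).mul sr.omegaPow) fun h => ?_
      exact hR r hr ((r₁.trans (boundedBy_ofReal_mul_right sr.omegaPow
        (omegaPow_pos sr.omegaPow) hs)).trans_le h)

theorem exists_omegaPow_boundedBy (x : Game.{u}) (hx : x.IsSurreal) (h0 : 0 < x) :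
    ∃ y : Game.{u}, y.IsSurreal ∧ BoundedBy x.val y.omegaPow.val ∧
      BoundedBy y.omegaPow.val x.val := by
  have ih : ∀ o, IsOption o x → 0 < o → ∃ y : Game.{u}, y.IsSurreal ∧
      BoundedBy o.val y.omegaPow.val ∧ BoundedBy y.omegaPow.val o.val :=
    fun o ho => exists_omegaPow_boundedBy o (hx.of_isOption ho)
  by_cases h : ∃ o, IsOption o x ∧ 0 < o ∧ BoundedBy x.val o.val ∧ BoundedBy o.val x.val
  · obtain ⟨o, ho, ho0, h₁, h₂⟩ := h
    obtain ⟨y, hy, h₃, h₄⟩ := ih o ho ho0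
    exact ⟨y, hy, h₁.trans h₃, h₄.trans h₂⟩
  · choose! Y hY using ih
    have h0' : (0 : Value.{u}) < x.val := val_lt_val.2 h0
    obtain ⟨y, hy, e⟩ := exists_omegaPow_of_options hx h0 Y hY
      (fun l hl hl0 hb => h ⟨l, Or.inl hl, hl0, hb, boundedBy_of_lt (val_lt_val.2 (hx.left_lt hl))⟩)
      (fun r hr hb => h ⟨r, Or.inr hr, h0.trans (hx.lt_right hr),
        boundedBy_of_lt (val_lt_val.2 (hx.lt_right hr)), hb⟩)
    have hb : BoundedBy x.val x.val := ⟨2, by rw [two_nsmul]; exact lt_add_of_pos_left _ h0'⟩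
    exact ⟨y, hy, by rwa [e], by rwa [e]⟩
termination_by x
decreasing_by exact ho

/-- `x ↦ r ω ^ y` on the reals. -/
noncomputable def IsSurreal.monomial {y : Game.{u}} (hy : y.IsSurreal) :
    ℝ →+ surrealSubgroup.{u} := hy.omegaPow.realMul

theorem IsSurreal.monomial_one {y : Game.{u}} (hy : y.IsSurreal) :
    hy.monomial 1 = hy.omegaPow.toVal := hy.omegaPow.realMul_one

theorem IsSurreal.monomial_strictMono {y : Game.{u}} (hy : y.IsSurreal) :
    StrictMono hy.monomial := hy.omegaPow.realMul_strictMono (omegaPow_pos hy.omegaPow)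

theorem infinitelyLess_iff {x y : Game.{u}} (hx : x.IsSurreal) (hy : y.IsSurreal) (r : ℝ) :
    InfinitelyLess (x - ofReal r * y.omegaPow).absVal y.omegaPow ↔
      ∀ k : ℕ, k ≠ 0 → k • |hx.toVal - hy.monomial r| < hy.monomial 1 := by
  have hs : (x - ofReal r * y.omegaPow).IsSurreal :=
    hx.sub ((isSurreal_ofReal r).mul hy.omegaPow)
  have e : hs.toVal = hx.toVal - hy.monomial r := Subtype.ext (val_sub _ _)
  unfold InfinitelyLess
  refine forall₂_congr fun k _ => ?_
  rw [← val_lt_val, mul_comm', val_ofInt_mul hs.absVal, hy.monomial_one, ← e, ← hs.toVal_absVal]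
  rfl

theorem commensurate_iff {x y : Game.{u}} (hx : x.IsSurreal) (hy : y.IsSurreal) :
    Commensurate x.absVal y.omegaPow.absVal ↔
      (∃ n : ℕ, |hx.toVal| < n • hy.monomial 1) ∧ ∃ m : ℕ, hy.monomial 1 < m • |hx.toVal| := by
  have hw := hy.omegaPow
  have e : y.omegaPow.absVal = y.omegaPow := if_pos (omegaPow_pos hw).le
  unfold Commensurate
  rw [e, hy.monomial_one, ← hx.toVal_absVal]
  refine and_congr (exists_congr fun n => ?_) (exists_congr fun m => ?_)
  · rw [← val_lt_val, val_ofInt_mul hw]; rfl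
  · rw [← val_lt_val, val_ofInt_mul hx.absVal]; rfl

theorem commensurate_of_infinitelyLess {x y : Game.{u}} (hx : x.IsSurreal) (hy : y.IsSurreal)
    {r : ℝ} (hr : r ≠ 0)
    (h : InfinitelyLess (x - ofReal r * y.omegaPow).absVal y.omegaPow) :
    Commensurate x.absVal y.omegaPow.absVal :=
  (commensurate_iff hx hy).2 (commensurate_of_leading_coeff hy.monomial hy.monomial_strictMono hr
    ((infinitelyLess_iff hx hy r).1 h))

/-- Through `|x|`, the power `ω^z` would be bounded by a natural multiple of `ω^y`, against the
strict growth of powers. -/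
theorem Commensurate.not_lt {x y z : Game.{u}} (hx : x.IsSurreal) (hy : y.IsSurreal)
    (hz : z.IsSurreal) (h : Commensurate x.absVal y.omegaPow.absVal)
    (h' : Commensurate x.absVal z.omegaPow.absVal) : ¬ y < z := by
  intro hlt
  obtain ⟨h, -⟩ := (commensurate_iff hx hy).1 h
  obtain ⟨-, h'⟩ := (commensurate_iff hx hz).1 h'
  rw [hy.monomial_one] at h
  rw [hz.monomial_one] at h'
  refine ((hy.omegaMono hz).2 hlt).not_boundedBy hy.omegaPow hz.omegaPow
    (omegaPow_pos hy.omegaPow) (BoundedBy.trans (b := (|hx.toVal|).1) h' h)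

theorem exists_leader {x : Game.{u}} (hx : x.IsSurreal) (hx0 : ¬ x.Equiv 0) :
    ∃ y : Game.{u}, y.IsUSurreal ∧ ∃ r : ℝ, r ≠ 0 ∧
      InfinitelyLess (x - ofReal r * y.omegaPow).absVal y.omegaPow := by
  have hne : hx.toVal ≠ 0 := fun h => hx0 (val_eq_val.1 (congrArg Subtype.val h))
  have habs : 0 < |hx.toVal| := abs_pos.2 hne
  have hpos : 0 < x.absVal := by
    rw [← hx.toVal_absVal] at habs
    exact val_lt_val.1 habs
  obtain ⟨y', hy', h₁, h₂⟩ := exists_omegaPow_boundedBy _ hx.absVal hpos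
  have hy := hy'.uniq
  -- The class of a power depends only on the class of its exponent, so passing to the canonical
  -- exponent keeps the commensurability.
  have e : y'.uniq.omegaPow.val = y'.omegaPow.val :=
    le_antisymm ((hy.omegaMono hy').1 hy'.uniq_equiv.1) ((hy'.omegaMono hy).1 hy'.uniq_equiv.2)
  rw [← e] at h₁ h₂
  refine ⟨y'.uniq, ⟨y', hy', rfl⟩, ?_⟩
  obtain ⟨r, hr, h⟩ := exists_leading_coeff hy.monomial hy.monomial_strictMono (x := |hx.toVal|)
    (by rw [hy.monomial_one, ← hx.toVal_absVal]; exact h₁)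
    (by rw [hy.monomial_one, ← hx.toVal_absVal]; exact h₂) habs
  rcases le_total 0 hx.toVal with h0 | h0
  · rw [abs_of_nonneg h0] at h
    exact ⟨r, hr.ne', (infinitelyLess_iff hx hy r).2 h⟩
  · rw [abs_of_nonpos h0] at h
    -- The coefficient was found for `|x|`; a negative `x` takes its opposite.
    refine ⟨-r, neg_ne_zero.2 hr.ne', (infinitelyLess_iff hx hy _).2 fun k hk => ?_⟩
    have := h k hk
    rwa [← abs_neg, neg_sub, sub_neg_eq_add, add_comm, ← sub_neg_eq_add, ← map_neg] at this

end Game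

/-! ### Existence, uniqueness and commensurability of the leader -/

theorem mainTheorem2 (x : Game.{u}) (hx : x.IsSurreal) (hx0 : ¬ x.Equiv 0) :
    (∃! y : Game.{u}, y.IsUSurreal ∧ ∃ r : ℝ, r ≠ 0 ∧
      Game.InfinitelyLess (x - Game.ofReal r * y.omegaPow).absVal y.omegaPow) ∧
    ∀ y : Game.{u}, y.IsUSurreal →
      (∃ r : ℝ, r ≠ 0 ∧
        Game.InfinitelyLess (x - Game.ofReal r * y.omegaPow).absVal y.omegaPow) →
      Game.Commensurate x.absVal y.omegaPow.absVal := by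
  have hcomm : ∀ y : Game.{u}, y.IsUSurreal →
      (∃ r : ℝ, r ≠ 0 ∧
        Game.InfinitelyLess (x - Game.ofReal r * y.omegaPow).absVal y.omegaPow) →
      Game.Commensurate x.absVal y.omegaPow.absVal := fun y hy ⟨_, hr, h⟩ =>
    Game.commensurate_of_infinitelyLess hx hy.isSurreal hr h
  refine ⟨?_, hcomm⟩
  obtain ⟨y, hy, h⟩ := Game.exists_leader hx hx0
  refine ⟨y, ⟨hy, h⟩, ?_⟩
  rintro z ⟨hz, h'⟩
  have c := hcomm y hy h
  have c' := hcomm z hz h'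
  have sy := hy.isSurreal
  have sz := hz.isSurreal
  refine hz.eq_of_equiv hy ⟨?_, ?_⟩
  · by_contra hle
    exact c.not_lt hx sy sz c' ((sy.lt_iff_not_le sz).2 hle)
  · by_contra hle
    exact c'.not_lt hx sz sy c ((sz.lt_iff_not_le sy).2 hle)
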